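/- Let $U:\mathbb R\to\mathbb R$ be a double-well potential: a $C^2$ function all of whose critical points are non-degenerate, whose local minima are exactly $x_0<x_2$ and whose only local maximum is $x_1\in(x_0,x_2)$, which is convex on $(-\infty,x_0]$ and on $[x_2,\infty)$ and satisfies $U(x)\to\infty$ as $|x|\to\infty$. Assume furthermore that $U(x_2)<U(x_0)$. For $\varepsilon>0$ let $(X^\varepsilon_t,Y^\varepsilon_t)_{t\ge 0}$ be the velocity jump process on $\mathbb R\times\{-1,1\}$ with generator $$L_\varepsilon f(x,y)=y\,\partial_x f(x,y)+\tfrac1\varepsilon\big(yU'(x)\big)_+\big(f(x,-y)-f(x,y)\big)$$ started at $(X^\varepsilon_0,Y^\varepsilon_0)=(x_0,-1)$. It is constructed from i.i.d. exponential variables $(E_k)_{k\ge0}$ of mean $1$ as follows: $T_0=0$; $T_{k+1}=\inf\{t>T_k:\int_{T_k}^t\frac1\varepsilon(Y^\varepsilon_{T_k}U'(X^\varepsilon_{T_k}+Y^\varepsilon_{T_k}(s-T_k)))_+\,ds\ge E_k\}$; on $[T_k,T_{k+1})$ the velocity is constant and $\frac{d}{dt}X^\varepsilon_t=Y^\varepsilon_t$;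 the position is continuous and the velocity changes sign at each time $T_{k+1}$. Let $\tau=\inf\{t>0:X^\varepsilon_t=x_1\}$, and let $\nu_s$ be the law of $(X^\varepsilon_s,Y^\varepsilon_s)$. Let $\mu_\varepsilon$ be the product of the probability measure on $\mathbb R$ proportional to $e^{-U(x)/\varepsilon}dx$ and of the uniform law on $\{-1,1\}$. Then for every $\varepsilon>0$ the measure $\mu_\varepsilon$ is the invariant law of the process, i.e. the unique probability measure $\mu$ on $\mathbb R\times\{-1,1\}$ such that $\int L_\varepsilon f\,d\mu=0$ for all $f$ that are $C^1$ and compactly supported in $x$; the state $(X^\varepsilon_s,Y^\varepsilon_s)$ is an (almost everywhere) measurable random variable for all $s\ge0$; and $\tau$ is integrable. Moreover, for every $t>0$, writing $t_\varepsilon=t\,\mathbb E[\tau]$, $$\liminf_{\varepsilon\to0^+}\ \|\nu_{t_\varepsilon}-\mu_\varepsilon\|_{TV}\ \ge\ e^{-t},$$ where $\|\nu-\tilde\nu\|_{TV}=\sup_A|\nu(A)-\tilde\nu(A)|$, the supremum being over Borel sets $A$. -/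

import Mathlib

open MeasureTheory ProbabilityTheory Filter Topology

noncomputable section

namespace VelocityJump

/-- A double-well potential with local minima `x₀ < x₂` separated by the local maximum `x₁`:
a `C²` function, all of whose critical points are non-degenerate, whose local extrema are exactly
`x₀`, `x₁`, `x₂`, convex on each side of the interval `(x₀, x₂)`, and tending to `+∞` at `±∞`. -/
structure IsDoubleWell (U : ℝ → ℝ) (x₀ x₁ x₂ : ℝ) : Prop where
  contDiff : ContDiff ℝ 2 U
  morse : ∀ x, deriv U x = 0 → deriv (deriv U) x ≠ 0
  lt_left : x₀ < x₁
  lt_right : x₁ < x₂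
  isLocalMin_iff : ∀ x, IsLocalMin U x ↔ x = x₀ ∨ x = x₂
  isLocalMax_iff : ∀ x, IsLocalMax U x ↔ x = x₁
  convex_left : ConvexOn ℝ (Set.Iic x₀) U
  convex_right : ConvexOn ℝ (Set.Ici x₂) U
  tendsto_atTop : Tendsto U (cocompact ℝ) atTop

/-- The state space `ℝ × {-1, 1}` of (position, velocity); the velocity set is `ℤˣ = {1, -1}`. -/
abbrev State : Type := ℝ × ℤˣ

/-- The velocity as a real number. -/
def vel (y : ℤˣ) : ℝ := ((y : ℤ) : ℝ)

/-- The jump rate `(y U'(x))₊ / ε`. -/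
def jumpRate (U : ℝ → ℝ) (ε : ℝ) (x : ℝ) (y : ℤˣ) : ℝ :=
  max (vel y * deriv U x) 0 / ε

/-- The next jump time after time `s`, when the process is at `z = (x, y)` at time `s` and the
exponential clock of the next jump has value `e`:
`inf {t > s : ∫ₛᵗ λ(x + y (r - s), y) dr ≥ e}`. -/
def nextJumpTime (U : ℝ → ℝ) (ε s : ℝ) (z : State) (e : ℝ) : ℝ :=
  sInf {t : ℝ | s < t ∧ e ≤ ∫ r in s..t, jumpRate U ε (z.1 + vel z.2 * (r - s)) z.2}

/-- The embedded chain `n ↦ (Tₙ, (X_{Tₙ}, Y_{Tₙ}))` of jump times and post-jump states, started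
from `T₀ = 0` and the state `z`, driven by the clocks `e 0, e 1, …`. -/
def jumpChain (U : ℝ → ℝ) (ε : ℝ) (z : State) (e : ℕ → ℝ) : ℕ → ℝ × State
  | 0 => (0, z)
  | n + 1 =>
    let p := jumpChain U ε z e n
    let T := nextJumpTime U ε p.1 p.2 (e n)
    (T, (p.2.1 + vel p.2.2 * (T - p.1), -p.2.2))

/-- The number of jumps up to time `t`, i.e. the `n` with `Tₙ ≤ t < Tₙ₊₁`. -/
def jumpCount (U : ℝ → ℝ) (ε : ℝ) (z : State) (e : ℕ → ℝ) (t : ℝ) : ℕ :=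
  sSup {n : ℕ | (jumpChain U ε z e n).1 ≤ t}

/-- The path `t ↦ (X_t, Y_t)` of the velocity jump process at temperature `ε` started from `z`. -/
def path (U : ℝ → ℝ) (ε : ℝ) (z : State) (e : ℕ → ℝ) (t : ℝ) : State :=
  let p := jumpChain U ε z e (jumpCount U ε z e t)
  (p.2.1 + vel p.2.2 * (t - p.1), p.2.2)

/-- The first hitting time `inf {t > 0 : X_t = a}`. -/
def hittingTime (U : ℝ → ℝ) (ε : ℝ) (z : State) (a : ℝ) (e : ℕ → ℝ) : ℝ :=
  sInf {t : ℝ | 0 < t ∧ (path U ε z e t).1 = a}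

/-- The generator
`L f(x, y) = y ∂ₓf(x, y) + (1/ε) (y U'(x))₊ (f(x, -y) - f(x, y))`. -/
def generator (U : ℝ → ℝ) (ε : ℝ) (f : State → ℝ) (z : State) : ℝ :=
  vel z.2 * deriv (fun x => f (x, z.2)) z.1
    + jumpRate U ε z.1 z.2 * (f (z.1, -z.2) - f z)

/-- `μ` is an invariant law: a probability measure with `∫ L f dμ = 0` for all test functions `f`
(compactly supported, continuously differentiable in the position). -/
def IsInvariantLaw (U : ℝ → ℝ) (ε : ℝ) (μ : Measure State) : Prop :=
  IsProbabilityMeasure μ ∧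
    ∀ f : State → ℝ, (∀ y, ContDiff ℝ 1 (fun x => f (x, y))) →
      (∀ y, HasCompactSupport (fun x => f (x, y))) → ∫ z, generator U ε f z ∂μ = 0

/-- The product of the Gibbs law `e^{-U(x)/ε} dx / ∫ e^{-U/ε}` and of the uniform law
on `{-1, 1}`. -/
def gibbs (U : ℝ → ℝ) (ε : ℝ) : Measure State :=
  ((volume : Measure ℝ).tilted (fun x => -U x / ε)).prod (uniformOn (Set.univ : Set ℤˣ))

/-- The total variation distance `sup_A |ν(A) - ν'(A)|`, over measurable sets `A`. -/
def tvDist {W : Type*} [MeasurableSpace W] (ν ν' : Measure W) : ℝ :=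
  ⨆ A : {A : Set W // MeasurableSet A}, |ν.real A - ν'.real A|

end VelocityJump

end

/-! The process only jumps while it climbs the potential, so it regenerates at the bottom `x₀`. A
flight arriving at `x₀` from either side of the left well comes downhill with zero jump rate, hence
meets `x₀` with its clock intact. From `x₀` the next jump occurs exactly when `U` has risen by `ε`
times the clock. The motion before hitting `x₁` is thus a sequence of i.i.d. excursions: even clocks
drive the left halves, odd clocks the right halves, and `x₁` is reached in the first excursion whose
right half travels at least `x₁ - x₀` (`jumpChain_cycle`, `hittingTime_eq`).

Let `p` be the probability of success of one excursion and `c` the mean duration of a truncated one.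
A Wald computation (`lintegral_totalTime`) gives `E[τ] ≤ c / p`; this upper bound is the only
estimate of `E[τ]` that is needed besides its nonnegativity. For `n` close to `(1 + δ) t / p`, the
first `n` excursions all fail with probability `(1 - p) ^ n`, which is asymptotically at least `exp
(-(1 + δ) t)`. By Chebyshev their truncated durations add up to more than `t E[τ]`, except with
probability of order `p / c ^ 2`. Since `p` is exponentially small in `1 / ε` and `c` is at least of
order `ε`, that error vanishes (`exists_le_measureReal`). A union bound combines the two events, so
failure and duration need not be independent.

The Gibbs mass of `{x < x₁}` vanishes because the right well is deeper (`tendsto_gibbs_left`).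
Testing the total variation on this set and letting `δ → 0` gives the bound.

For uniqueness of the invariant law, test functions of the position alone show that the two velocity
slices agree. Functions living on one velocity then give the integration by parts formula of `exp
(-U / ε)`, so that `exp (U / ε)` times a slice is translation invariant, hence a multiple of
Lebesgue measure. -/

noncomputable section

namespace VelocityJump

/-! ### Shape and growth of the potential -/

/-- A continuous function without zeros on a preconnected set has constant sign there. -/
lemma forall_pos_or_forall_neg_of_isPreconnected {g : ℝ → ℝ} {s : Set ℝ} (hs : IsPreconnected s)
    (hg : ContinuousOn g s) (h0 : ∀ x ∈ s, g x ≠ 0) :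
    (∀ x ∈ s, 0 < g x) ∨ (∀ x ∈ s, g x < 0) := by
  by_contra! hcon
  obtain ⟨⟨a, ha, hga⟩, b, hb, hgb⟩ := hcon
  obtain ⟨c, hc, hgc⟩ := hs.intermediate_value ha hb hg ⟨hga, hgb⟩
  exact h0 c hc hgc

/-- A convex function tending to `∞` at `+∞` grows at least linearly. -/
lemma exists_pos_eventually_mul_le {f : ℝ → ℝ} {c : ℝ} (hf : ConvexOn ℝ (Set.Ici c) f)
    (h : Tendsto f atTop atTop) : ∃ b : ℝ, 0 < b ∧ ∀ᶠ x in atTop, b * x ≤ f x := by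
  obtain ⟨y, hy, hyc⟩ := ((h.eventually_gt_atTop (f c)).and (eventually_gt_atTop c)).exists
  have hm : 0 < (f y - f c) / (y - c) := div_pos (by linarith) (by linarith)
  set m := (f y - f c) / (y - c) with hmdef
  have key : ∀ x, y < x → f c + m * (x - c) ≤ f x := by
    intro x hx
    have h1 := hf.secant_mono (a := c) (x := y) (y := x) (by simp) (by simp [hyc.le])
      (by simp; linarith) hyc.ne' (by linarith) hx.le
    rw [← hmdef, le_div_iff₀ (by linarith)] at h1
    linarith
  refine ⟨m / 2, by positivity, ?_⟩
  filter_upwards [eventually_gt_atTop y, eventually_ge_atTop ((m * c - f c) / (m / 2))]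
    with x hx hx2
  have := key x hx
  rw [div_le_iff₀ (by positivity)] at hx2
  nlinarith

lemma integrable_exp_neg_mul_abs {b : ℝ} (hb : 0 < b) :
    Integrable (fun x : ℝ => Real.exp (-b * |x|)) := by
  -- Starting the open half-line at `-1` makes it and its reflection cover `0` as well.
  have h1 : Integrable ((Set.Ioi (-1 : ℝ)).indicator fun x => Real.exp (-b * x)) :=
    (exp_neg_integrableOn_Ioi (-1) hb).integrable_indicator measurableSet_Ioi
  refine (h1.add h1.comp_neg).mono' (Continuous.aestronglyMeasurable (by fun_prop))
    (Eventually.of_forall fun x => ?_)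
  rw [Real.norm_of_nonneg (Real.exp_pos _).le, Pi.add_apply]
  have hnn : ∀ y, 0 ≤ (Set.Ioi (-1 : ℝ)).indicator (fun x => Real.exp (-b * x)) y :=
    fun y => Set.indicator_nonneg (fun _ _ => (Real.exp_pos _).le) _
  rcases le_total 0 x with h | h
  · rw [abs_of_nonneg h, Set.indicator_of_mem (Set.mem_Ioi.2 (by linarith))]
    linarith [hnn (-x)]
  · rw [abs_of_nonpos h, Set.indicator_of_mem (a := -x) (Set.mem_Ioi.2 (by linarith))]
    linarith [hnn x]

namespace IsDoubleWell

variable {U : ℝ → ℝ} {x₀ x₁ x₂ : ℝ}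

lemma differentiable (hU : IsDoubleWell U x₀ x₁ x₂) : Differentiable ℝ U :=
  hU.contDiff.differentiable (by norm_num)

lemma continuous (hU : IsDoubleWell U x₀ x₁ x₂) : Continuous U := hU.differentiable.continuous

lemma continuous_deriv (hU : IsDoubleWell U x₀ x₁ x₂) : Continuous (deriv U) :=
  hU.contDiff.continuous_deriv (by norm_num)

lemma hasDerivAt (hU : IsDoubleWell U x₀ x₁ x₂) (x : ℝ) : HasDerivAt U (deriv U x) x :=
  (hU.differentiable x).hasDerivAt

/-- By non-degeneracy and the second derivative test, every critical point is a local extremum, and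
these are listed. -/
lemma deriv_ne_zero (hU : IsDoubleWell U x₀ x₁ x₂) {x : ℝ} (h0 : x ≠ x₀) (h1 : x ≠ x₁)
    (h2 : x ≠ x₂) : deriv U x ≠ 0 := by
  intro h
  rcases lt_or_gt_of_ne (hU.morse x h) with h' | h'
  · exact h1 ((hU.isLocalMax_iff x).1
      (isLocalMax_of_deriv_deriv_neg h' h hU.continuous.continuousAt))
  · rcases (hU.isLocalMin_iff x).1
      (isLocalMin_of_deriv_deriv_pos h' h hU.continuous.continuousAt) with h | h
    exacts [h0 h, h2 h]

/-- The derivative has no zero on the half-line, hence a constant sign; a positive sign would make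
`U` increase up to its local minimum `x₀`. -/
lemma deriv_neg (hU : IsDoubleWell U x₀ x₁ x₂) {x : ℝ} (hx : x < x₀) : deriv U x < 0 := by
  have h01 := hU.lt_left
  have h12 := hU.lt_right
  rcases forall_pos_or_forall_neg_of_isPreconnected (isPreconnected_Iio (a := x₀))
    hU.continuous_deriv.continuousOn (fun y hy => by
      simp only [Set.mem_Iio] at hy
      exact hU.deriv_ne_zero (by linarith) (by linarith) (by linarith)) with h | h
  · exfalso
    have hmono : StrictMonoOn U (Set.Iic x₀) := strictMonoOn_of_deriv_pos (convex_Iic x₀)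
      hU.continuous.continuousOn (by simpa using h)
    have hmin : IsLocalMin U x₀ := (hU.isLocalMin_iff x₀).2 (Or.inl rfl)
    have h1 : ∀ᶠ y in 𝓝[<] x₀, U x₀ ≤ U y := hmin.filter_mono nhdsWithin_le_nhds
    obtain ⟨y, hy, hy'⟩ := (h1.and self_mem_nhdsWithin).exists
    exact absurd (hmono (Set.mem_Iic.2 (le_of_lt hy')) (by simp) hy') (not_lt.2 hy)
  · exact h x hx

lemma deriv_pos (hU : IsDoubleWell U x₀ x₁ x₂) {x : ℝ} (hx : x ∈ Set.Ioo x₀ x₁) :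
    0 < deriv U x := by
  have h01 := hU.lt_left
  have h12 := hU.lt_right
  rcases forall_pos_or_forall_neg_of_isPreconnected (isPreconnected_Ioo (a := x₀) (b := x₁))
    hU.continuous_deriv.continuousOn (fun y hy => by
      exact hU.deriv_ne_zero hy.1.ne' hy.2.ne (by linarith [hy.2])) with h | h
  · exact h x hx
  · exfalso
    have hmono : StrictAntiOn U (Set.Icc x₀ x₁) := strictAntiOn_of_deriv_neg (convex_Icc x₀ x₁)
      hU.continuous.continuousOn (by simpa using h)
    have hmin : IsLocalMin U x₀ := (hU.isLocalMin_iff x₀).2 (Or.inl rfl)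
    have h1 : ∀ᶠ y in 𝓝[>] x₀, U x₀ ≤ U y := hmin.filter_mono nhdsWithin_le_nhds
    obtain ⟨y, hy, hy'⟩ := (h1.and (Ioo_mem_nhdsGT h01)).exists
    exact absurd (hmono (by simp [h01.le]) ⟨hy'.1.le, hy'.2.le⟩ hy'.1) (not_lt.2 hy)

lemma deriv_nonpos (hU : IsDoubleWell U x₀ x₁ x₂) {x : ℝ} (hx : x ≤ x₀) : deriv U x ≤ 0 := by
  rcases hx.lt_or_eq with h | rfl
  · exact (hU.deriv_neg h).le
  · exact ((hU.isLocalMin_iff x).2 (Or.inl rfl)).deriv_eq_zero.le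

lemma deriv_nonneg (hU : IsDoubleWell U x₀ x₁ x₂) {x : ℝ} (hx : x ∈ Set.Icc x₀ x₁) :
    0 ≤ deriv U x := by
  rcases hx.1.lt_or_eq with h | rfl
  · rcases hx.2.lt_or_eq with h' | rfl
    · exact (hU.deriv_pos ⟨h, h'⟩).le
    · exact ((hU.isLocalMax_iff x).2 rfl).deriv_eq_zero.ge
  · exact ((hU.isLocalMin_iff x₀).2 (Or.inl rfl)).deriv_eq_zero.ge

lemma strictAntiOn (hU : IsDoubleWell U x₀ x₁ x₂) : StrictAntiOn U (Set.Iic x₀) :=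
  strictAntiOn_of_deriv_neg (convex_Iic x₀) hU.continuous.continuousOn
    (by simpa using fun x hx => hU.deriv_neg hx)

lemma strictMonoOn (hU : IsDoubleWell U x₀ x₁ x₂) : StrictMonoOn U (Set.Icc x₀ x₁) :=
  strictMonoOn_of_deriv_pos (convex_Icc x₀ x₁) hU.continuous.continuousOn
    (by rw [interior_Icc]; exact fun x hx => hU.deriv_pos hx)

lemma barrier_pos (hU : IsDoubleWell U x₀ x₁ x₂) : 0 < U x₁ - U x₀ :=
  sub_pos.2 (hU.strictMonoOn (by simp [hU.lt_left.le]) (by simp [hU.lt_left.le]) hU.lt_left)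

lemma le_of_le (hU : IsDoubleWell U x₀ x₁ x₂) {x : ℝ} (hx : x ≤ x₁) : U x₀ ≤ U x := by
  rcases le_total x x₀ with h | h
  · exact hU.strictAntiOn.antitoneOn h (by simp) h
  · exact hU.strictMonoOn.monotoneOn (by simp [hU.lt_left.le]) ⟨h, hx⟩ h

lemma tendsto_atTop_atTop (hU : IsDoubleWell U x₀ x₁ x₂) : Tendsto U atTop atTop :=
  hU.tendsto_atTop.mono_left atTop_le_cocompact

lemma tendsto_atBot_atTop (hU : IsDoubleWell U x₀ x₁ x₂) : Tendsto U atBot atTop :=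
  hU.tendsto_atTop.mono_left atBot_le_cocompact

/-- A double-well potential grows at least linearly. -/
lemma exists_mul_abs_sub_le (hU : IsDoubleWell U x₀ x₁ x₂) :
    ∃ b : ℝ, 0 < b ∧ ∃ a : ℝ, ∀ x, b * |x| - a ≤ U x := by
  obtain ⟨b, hb, hb'⟩ := exists_pos_eventually_mul_le hU.convex_right hU.tendsto_atTop_atTop
  have hleft : ConvexOn ℝ (Set.Ici (-x₀)) (fun x => U (-x)) := by
    have := hU.convex_left.comp_linearMap (-LinearMap.id)
    refine (this.congr (fun x _ => rfl)).subset (fun x hx => ?_) (convex_Ici _)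
    simp only [Set.mem_Ici, Set.mem_preimage, LinearMap.neg_apply, LinearMap.id_apply,
      Set.mem_Iic] at hx ⊢
    linarith
  obtain ⟨c, hc, hc'⟩ := exists_pos_eventually_mul_le hleft
    (hU.tendsto_atBot_atTop.comp tendsto_neg_atTop_atBot)
  obtain ⟨R, hR⟩ := eventually_atTop.1 (hb'.and hc')
  have hcont : Continuous fun x => min b c * |x| - U x :=
    (continuous_const.mul continuous_abs).sub hU.continuous
  obtain ⟨a, ha⟩ := (isCompact_Icc (a := -R) (b := R)).bddAbove_image hcont.continuousOn
  refine ⟨min b c, lt_min hb hc, max a 0, fun x => ?_⟩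
  by_cases hx : x ∈ Set.Icc (-R) R
  · have : min b c * |x| - U x ≤ a := ha (Set.mem_image_of_mem _ hx)
    linarith [le_max_left a 0]
  · have h0 := le_max_right a 0
    rw [Set.mem_Icc, not_and_or, not_le, not_le] at hx
    rcases le_total 0 x with h | h
    · rw [abs_of_nonneg h]
      have h1 : R ≤ x := by
        rcases hx with hx | hx
        · linarith
        · exact hx.le
      nlinarith [(hR x h1).1, min_le_left b c]
    · rw [abs_of_nonpos h]
      have h1 : R ≤ -x := by rcases hx with hx | hx <;> linarith
      have h2 := (hR (-x) h1).2
      simp only [neg_neg] at h2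
      nlinarith [min_le_right b c]

/-- The Gibbs weight is integrable. -/
lemma integrable_exp (hU : IsDoubleWell U x₀ x₁ x₂) {ε : ℝ} (hε : 0 < ε) :
    Integrable (fun x => Real.exp (-U x / ε)) := by
  obtain ⟨b, hb, a, ha⟩ := hU.exists_mul_abs_sub_le
  have h1 : Integrable (fun x : ℝ => Real.exp (a / ε) * Real.exp (-(b / ε) * |x|)) :=
    (integrable_exp_neg_mul_abs (by positivity)).const_mul _
  refine h1.mono' (by
    have := hU.continuous
    exact Continuous.aestronglyMeasurable (by fun_prop)) (Eventually.of_forall fun x => ?_)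
  rw [Real.norm_of_nonneg (Real.exp_pos _).le, ← Real.exp_add, Real.exp_le_exp,
    show a / ε + -(b / ε) * |x| = (a - b * |x|) / ε by ring]
  gcongr
  linarith [ha x]

end IsDoubleWell

/-! ### Free flights and exponential clocks -/

section

/-- The integral of the jump rate along the free flight of duration `t` started from `z`. -/
def cumRate (U : ℝ → ℝ) (ε : ℝ) (z : State) (t : ℝ) : ℝ :=
  ∫ r in (0 : ℝ)..t, jumpRate U ε (z.1 + vel z.2 * r) z.2

/-- The duration of the free flight started from `z` when the exponential clock is `e`. -/
def holdingTime (U : ℝ → ℝ) (ε : ℝ) (z : State) (e : ℝ) : ℝ :=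
  sInf {u : ℝ | 0 < u ∧ e ≤ cumRate U ε z u}

@[simp] lemma vel_one : vel 1 = 1 := by simp [vel]

@[simp] lemma vel_neg (y : ℤˣ) : vel (-y) = -vel y := by simp [vel]

lemma vel_eq_or (y : ℤˣ) : vel y = 1 ∨ vel y = -1 := by
  rcases Int.units_eq_one_or y with rfl | rfl <;> simp

instance : MeasurableSingletonClass ℤˣ :=
  ⟨fun y => ⟨{(y : ℤ)}, measurableSet_singleton _, by ext; simp [Units.ext_iff]⟩⟩

lemma integral_jumpRate (U : ℝ → ℝ) (ε s t : ℝ) (z : State) :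
    ∫ r in s..t, jumpRate U ε (z.1 + vel z.2 * (r - s)) z.2 = cumRate U ε z (t - s) := by
  rw [intervalIntegral.integral_comp_sub_right
    (fun r => jumpRate U ε (z.1 + vel z.2 * r) z.2) s, sub_self, cumRate]

variable {U : ℝ → ℝ} {x₀ x₁ x₂ ε : ℝ}

lemma jumpRate_nonneg (hε : 0 < ε) (x : ℝ) (y : ℤˣ) : 0 ≤ jumpRate U ε x y :=
  div_nonneg (le_max_right _ _) hε.le

lemma cumRate_zero (z : State) : cumRate U ε z 0 = 0 := by simp [cumRate]

namespace IsDoubleWell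

lemma continuous_jumpRate (hU : IsDoubleWell U x₀ x₁ x₂) (ε : ℝ) (y : ℤˣ) :
    Continuous fun x => jumpRate U ε x y := by
  have := hU.continuous_deriv
  unfold jumpRate
  fun_prop

lemma intervalIntegrable_jumpRate (hU : IsDoubleWell U x₀ x₁ x₂) (ε : ℝ) (z : State) (a b : ℝ) :
    IntervalIntegrable (fun r => jumpRate U ε (z.1 + vel z.2 * r) z.2) volume a b :=
  ((hU.continuous_jumpRate ε z.2).comp
    (continuous_const.add (continuous_const.mul continuous_id))).intervalIntegrable _ _

lemma continuous_cumRate (hU : IsDoubleWell U x₀ x₁ x₂) (ε : ℝ) (z : State) :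
    Continuous (cumRate U ε z) :=
  intervalIntegral.continuous_primitive (fun a b => hU.intervalIntegrable_jumpRate ε z a b) 0

lemma cumRate_add (hU : IsDoubleWell U x₀ x₁ x₂) (ε : ℝ) (z : State) (d t : ℝ) :
    cumRate U ε z (d + t) = cumRate U ε z d + cumRate U ε (z.1 + vel z.2 * d, z.2) t := by
  have h := intervalIntegral.integral_add_adjacent_intervals
    (hU.intervalIntegrable_jumpRate ε z 0 d) (hU.intervalIntegrable_jumpRate ε z d (d + t))
  rw [cumRate, ← h, cumRate, add_right_inj]
  have h2 := intervalIntegral.integral_comp_add_left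
    (fun r => jumpRate U ε (z.1 + vel z.2 * r) z.2) d (a := 0) (b := t)
  rw [add_zero] at h2
  rw [← h2, cumRate]
  congr 1
  ext r
  ring_nf

lemma monotone_cumRate (hU : IsDoubleWell U x₀ x₁ x₂) (hε : 0 < ε) (z : State) :
    Monotone (cumRate U ε z) := by
  intro a b hab
  have := hU.cumRate_add ε z a (b - a)
  rw [add_sub_cancel] at this
  rw [this, le_add_iff_nonneg_right]
  exact intervalIntegral.integral_nonneg (by linarith) (fun r _ => jumpRate_nonneg hε _ _)

lemma integral_deriv_flight (hU : IsDoubleWell U x₀ x₁ x₂) (ε : ℝ) (z : State) (t : ℝ) :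
    ∫ r in (0 : ℝ)..t, vel z.2 * deriv U (z.1 + vel z.2 * r) / ε =
      (U (z.1 + vel z.2 * t) - U z.1) / ε := by
  have hc := hU.continuous_deriv
  rw [intervalIntegral.integral_eq_sub_of_hasDerivAt
    (f := fun r => U (z.1 + vel z.2 * r) / ε) (fun r _ => ?_)
    (Continuous.intervalIntegrable (by fun_prop) _ _)]
  · simp [sub_div]
  · have h1 : HasDerivAt (fun r => z.1 + vel z.2 * r) (vel z.2) r := by
      simpa using ((hasDerivAt_id r).const_mul (vel z.2)).const_add z.1
    have := ((hU.hasDerivAt _).comp r h1).div_const ε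
    rwa [mul_comm] at this

/-- The positive part dominates the rate of change of `U` along the flight. As `U` tends to infinity
in both directions, every clock eventually rings. -/
lemma le_cumRate (hU : IsDoubleWell U x₀ x₁ x₂) (hε : 0 < ε) (z : State) {t : ℝ} (ht : 0 ≤ t) :
    (U (z.1 + vel z.2 * t) - U z.1) / ε ≤ cumRate U ε z t := by
  have hc := hU.continuous_deriv
  rw [← hU.integral_deriv_flight]
  refine intervalIntegral.integral_mono_on ht (Continuous.intervalIntegrable (by fun_prop) _ _)
    (hU.intervalIntegrable_jumpRate ε z 0 t) (fun r _ => ?_)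
  exact div_le_div_of_nonneg_right (le_max_left _ _) hε.le

lemma cumRate_eq (hU : IsDoubleWell U x₀ x₁ x₂) (ε : ℝ) (z : State) {t : ℝ} (ht : 0 ≤ t)
    (h : ∀ r ∈ Set.Icc 0 t, 0 ≤ vel z.2 * deriv U (z.1 + vel z.2 * r)) :
    cumRate U ε z t = (U (z.1 + vel z.2 * t) - U z.1) / ε := by
  rw [← hU.integral_deriv_flight]
  refine intervalIntegral.integral_congr fun r hr => ?_
  rw [Set.uIcc_of_le ht] at hr
  simp only [jumpRate]
  rw [max_eq_left (h r hr)]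

lemma _root_.VelocityJump.cumRate_eq_zero {z : State} {t : ℝ} (ht : 0 ≤ t)
    (h : ∀ r ∈ Set.Icc 0 t, vel z.2 * deriv U (z.1 + vel z.2 * r) ≤ 0) :
    cumRate U ε z t = 0 := by
  rw [cumRate, intervalIntegral.integral_congr (g := fun _ => 0) fun r hr => ?_,
    intervalIntegral.integral_zero]
  rw [Set.uIcc_of_le ht] at hr
  simp only [jumpRate]
  rw [max_eq_right (h r hr), zero_div]

lemma tendsto_cumRate (hU : IsDoubleWell U x₀ x₁ x₂) (hε : 0 < ε) (z : State) :
    Tendsto (cumRate U ε z) atTop atTop := by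
  have h1 : Tendsto (fun t => U (z.1 + vel z.2 * t)) atTop atTop := by
    rcases vel_eq_or z.2 with h | h
    · simp only [h, one_mul]
      exact hU.tendsto_atTop_atTop.comp (tendsto_atTop_add_const_left _ _ tendsto_id)
    · simp only [h, neg_one_mul]
      exact hU.tendsto_atBot_atTop.comp
        (tendsto_atBot_add_const_left _ _ tendsto_neg_atTop_atBot)
  have h2 : Tendsto (fun t => (U (z.1 + vel z.2 * t) - U z.1) / ε) atTop atTop :=
    (tendsto_atTop_add_const_right _ (-U z.1) h1).atTop_div_const hε
  exact tendsto_atTop_mono' _ ((eventually_ge_atTop 0).mono fun t ht => hU.le_cumRate hε z ht) h2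

lemma holdingSet_nonempty (hU : IsDoubleWell U x₀ x₁ x₂) (hε : 0 < ε) (z : State) (e : ℝ) :
    {u : ℝ | 0 < u ∧ e ≤ cumRate U ε z u}.Nonempty :=
  ((eventually_gt_atTop 0).and ((hU.tendsto_cumRate hε z).eventually_ge_atTop e)).exists

lemma _root_.VelocityJump.bddBelow_holdingSet (U : ℝ → ℝ) (ε : ℝ) (z : State) (e : ℝ) :
    BddBelow {u : ℝ | 0 < u ∧ e ≤ cumRate U ε z u} := ⟨0, fun _ h => h.1.le⟩

lemma nextJumpTime_eq (hU : IsDoubleWell U x₀ x₁ x₂) (hε : 0 < ε) (s : ℝ) (z : State) (e : ℝ) :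
    nextJumpTime U ε s z e = s + holdingTime U ε z e := by
  have h := (OrderIso.addLeft s).map_csInf' (hU.holdingSet_nonempty hε z e)
    (bddBelow_holdingSet U ε z e)
  rw [OrderIso.addLeft_apply] at h
  rw [holdingTime, h, nextJumpTime]
  congr 1
  ext t
  simp only [Set.mem_ofPred_eq, integral_jumpRate, Set.mem_image, OrderIso.addLeft_apply]
  constructor
  · rintro ⟨h1, h2⟩
    exact ⟨t - s, ⟨by linarith, h2⟩, by ring⟩
  · rintro ⟨u, ⟨h1, h2⟩, rfl⟩
    exact ⟨by linarith, by simpa using h2⟩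

lemma _root_.VelocityJump.holdingTime_le {z : State} {e u : ℝ} (hu : 0 < u)
    (h : e ≤ cumRate U ε z u) : holdingTime U ε z e ≤ u :=
  csInf_le (bddBelow_holdingSet U ε z e) ⟨hu, h⟩

lemma _root_.VelocityJump.cumRate_lt {z : State} {e u : ℝ} (hu : 0 < u)
    (h : u < holdingTime U ε z e) : cumRate U ε z u < e := by
  by_contra! hcon
  exact absurd (holdingTime_le hu hcon) (not_le.2 h)

lemma holdingTime_nonneg (hU : IsDoubleWell U x₀ x₁ x₂) (hε : 0 < ε) (z : State) (e : ℝ) :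
    0 ≤ holdingTime U ε z e :=
  le_csInf (hU.holdingSet_nonempty hε z e) fun _ h => h.1.le

/-- The infimum lies in the closure of the defining set. For `e ≤ 0` it may equal `0`, which is not
in that set, so only the closed condition passes to it. -/
lemma le_cumRate_holdingTime (hU : IsDoubleWell U x₀ x₁ x₂) (hε : 0 < ε) (z : State) (e : ℝ) :
    e ≤ cumRate U ε z (holdingTime U ε z e) := by
  have hmem := csInf_mem_closure (hU.holdingSet_nonempty hε z e) (bddBelow_holdingSet U ε z e)
  have hcl : IsClosed {u | e ≤ cumRate U ε z u} :=
    isClosed_le continuous_const (hU.continuous_cumRate ε z)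
  exact closure_minimal (fun u hu => hu.2) hcl hmem

lemma holdingTime_pos (hU : IsDoubleWell U x₀ x₁ x₂) (hε : 0 < ε) (z : State) {e : ℝ}
    (he : 0 < e) : 0 < holdingTime U ε z e := by
  refine (hU.holdingTime_nonneg hε z e).lt_of_ne fun h => ?_
  have := hU.le_cumRate_holdingTime hε z e
  rw [← h, cumRate_zero] at this
  linarith

lemma cumRate_holdingTime (hU : IsDoubleWell U x₀ x₁ x₂) (hε : 0 < ε) (z : State) {e : ℝ}
    (he : 0 < e) : cumRate U ε z (holdingTime U ε z e) = e := by
  refine le_antisymm ?_ (hU.le_cumRate_holdingTime hε z e)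
  have h1 : Tendsto (cumRate U ε z) (𝓝[<] holdingTime U ε z e)
      (𝓝 (cumRate U ε z (holdingTime U ε z e))) :=
    (hU.continuous_cumRate ε z).continuousAt.mono_left nhdsWithin_le_nhds
  refine le_of_tendsto h1 ?_
  filter_upwards [Ioo_mem_nhdsLT (hU.holdingTime_pos hε z he)] with u hu
  exact (cumRate_lt hu.1 hu.2).le

/-- A flight starts with the part along which the jump rate vanishes. -/
lemma holdingTime_eq_add (hU : IsDoubleWell U x₀ x₁ x₂) (hε : 0 < ε) {z : State} {d e : ℝ}
    (he : 0 < e) (hd : 0 ≤ d)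
    (h : ∀ r ∈ Set.Icc 0 d, vel z.2 * deriv U (z.1 + vel z.2 * r) ≤ 0) :
    holdingTime U ε z e = d + holdingTime U ε (z.1 + vel z.2 * d, z.2) e := by
  have h0 : cumRate U ε z d = 0 := cumRate_eq_zero hd h
  have hpos := hU.holdingTime_pos hε (z.1 + vel z.2 * d, z.2) he
  apply le_antisymm
  · apply holdingTime_le (by linarith)
    rw [hU.cumRate_add, h0, zero_add]
    exact hU.le_cumRate_holdingTime hε _ e
  · have h1 := hU.le_cumRate_holdingTime hε z e
    have hlt : d < holdingTime U ε z e := by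
      by_contra! hcon
      have := hU.monotone_cumRate hε z hcon
      linarith
    have h2 := hU.cumRate_add ε z d (holdingTime U ε z e - d)
    rw [add_sub_cancel, h0, zero_add] at h2
    have := holdingTime_le (U := U) (ε := ε) (z := (z.1 + vel z.2 * d, z.2)) (e := e)
      (sub_pos.2 hlt) (h2 ▸ h1)
    linarith

/-- Regeneration at `x₀`: the descent towards the bottom consumes none of the clock. The next lemma
is the same fact for a descent from the right. -/
lemma holdingTime_right (hU : IsDoubleWell U x₀ x₁ x₂) (hε : 0 < ε) {d e : ℝ}
    (he : 0 < e) (hd : 0 ≤ d) :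
    holdingTime U ε (x₀ - d, 1) e = d + holdingTime U ε (x₀, 1) e := by
  rw [hU.holdingTime_eq_add hε he hd]
  · simp
  · intro r hr
    simpa using hU.deriv_nonpos (x := x₀ - d + r) (by linarith [hr.2])

lemma holdingTime_left (hU : IsDoubleWell U x₀ x₁ x₂) (hε : 0 < ε) {d e : ℝ}
    (he : 0 < e) (hd : 0 ≤ d) (hd' : d ≤ x₁ - x₀) :
    holdingTime U ε (x₀ + d, -1) e = d + holdingTime U ε (x₀, -1) e := by
  rw [hU.holdingTime_eq_add hε he hd]
  · simp
  · intro r hr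
    have := hU.deriv_nonneg (x := x₀ + d + -r) ⟨by linarith [hr.2], by linarith [hr.1]⟩
    simpa using this

/-- Uphill the accumulated rate is the energy gained divided by `ε`, which turns statements about
clocks into statements about heights of `U`. -/
lemma cumRate_left (hU : IsDoubleWell U x₀ x₁ x₂) (ε : ℝ) {t : ℝ} (ht : 0 ≤ t) :
    cumRate U ε (x₀, -1) t = (U (x₀ - t) - U x₀) / ε := by
  rw [hU.cumRate_eq ε _ ht fun r hr => ?_]
  · simp [sub_eq_add_neg]
  · have := hU.deriv_nonpos (x := x₀ + -r) (by linarith [hr.1])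
    simpa using this

lemma cumRate_right (hU : IsDoubleWell U x₀ x₁ x₂) (ε : ℝ) {t : ℝ} (ht : 0 ≤ t)
    (ht' : t ≤ x₁ - x₀) : cumRate U ε (x₀, 1) t = (U (x₀ + t) - U x₀) / ε := by
  rw [hU.cumRate_eq ε _ ht fun r hr => ?_]
  · simp
  · have := hU.deriv_nonneg (x := x₀ + r) ⟨by linarith [hr.1], by linarith [hr.2]⟩
    simpa using this

/-! ### Measurability of the path in the clocks -/

lemma measurable_cumRate (hU : IsDoubleWell U x₀ x₁ x₂) (ε t : ℝ) :
    Measurable fun z => cumRate U ε z t := by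
  refine measurable_from_prod_countable_left fun y => Continuous.measurable ?_
  refine intervalIntegral.continuous_parametric_intervalIntegral_of_continuous' ?_ 0 t
  have := hU.continuous_jumpRate ε y
  exact this.comp (by fun_prop : Continuous fun p : ℝ × ℝ => p.1 + vel y * p.2)

lemma measurable_holdingTime (hU : IsDoubleWell U x₀ x₁ x₂) (hε : 0 < ε) :
    Measurable fun p : State × ℝ => holdingTime U ε p.1 p.2 := by
  refine measurable_of_Iio fun a => ?_
  -- Rational times suffice because the accumulated rate is nondecreasing.
  have : (fun p : State × ℝ => holdingTime U ε p.1 p.2) ⁻¹' Set.Iio a =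
      ⋃ q : ℚ, {p | 0 < (q : ℝ) ∧ (q : ℝ) < a ∧ p.2 ≤ cumRate U ε p.1 q} := by
    ext p
    simp only [Set.mem_preimage, Set.mem_Iio, Set.mem_iUnion, Set.mem_ofPred_eq]
    constructor
    · intro h
      obtain ⟨u, ⟨hu, hu'⟩, hua⟩ := exists_lt_of_csInf_lt (hU.holdingSet_nonempty hε p.1 p.2) h
      obtain ⟨q, hq, hq'⟩ := exists_rat_btwn hua
      exact ⟨q, hu.trans hq, hq', hu'.trans (hU.monotone_cumRate hε _ hq.le)⟩
    · rintro ⟨q, h1, h2, h3⟩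
      exact (holdingTime_le h1 h3).trans_lt h2
  rw [this]
  refine MeasurableSet.iUnion fun q => ?_
  refine (MeasurableSet.const _).inter ((MeasurableSet.const _).inter ?_)
  exact measurableSet_le measurable_snd ((hU.measurable_cumRate ε q).comp measurable_fst)

lemma measurable_jumpChain (hU : IsDoubleWell U x₀ x₁ x₂) (hε : 0 < ε) (z : State) (n : ℕ) :
    Measurable fun e : ℕ → ℝ => jumpChain U ε z e n := by
  induction n with
  | zero => exact measurable_const
  | succ n ih =>
    have hT : Measurable fun e : ℕ → ℝ => nextJumpTime U ε (jumpChain U ε z e n).1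
        (jumpChain U ε z e n).2 (e n) := by
      simp only [hU.nextJumpTime_eq hε]
      exact ih.fst.add ((hU.measurable_holdingTime hε).comp (ih.snd.prodMk (measurable_pi_apply n)))
    have hv : Measurable fun e : ℕ → ℝ => vel (jumpChain U ε z e n).2.2 :=
      (measurable_of_countable vel).comp ih.snd.snd
    exact hT.prodMk ((ih.snd.fst.add (hv.mul (hT.sub ih.fst))).prodMk
      ((measurable_of_countable fun y : ℤˣ => -y).comp ih.snd.snd))

/-- The supremum is `0` by convention on empty and unbounded sets. Expressing it by countably many
membership conditions gives measurability of the jump count for all clock sequences, including those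
whose jump times accumulate. -/
lemma _root_.VelocityJump.nat_sSup_eq_iff (S : Set ℕ) (n : ℕ) :
    sSup S = n ↔ (n ∈ S ∧ ∀ m ∈ S, m ≤ n) ∨ (n = 0 ∧ ∀ k, ¬ (k ∈ S ∧ ∀ m ∈ S, m ≤ k)) := by
  have h1 : ∀ k, (k ∈ S ∧ ∀ m ∈ S, m ≤ k) → sSup S = k := fun k hk =>
    IsGreatest.csSup_eq hk
  constructor
  · rintro rfl
    by_cases hS : S.Nonempty ∧ BddAbove S
    · exact Or.inl ⟨Nat.sSup_mem hS.1 hS.2, fun m hm => le_csSup hS.2 hm⟩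
    · refine Or.inr ⟨?_, fun k hk => hS ⟨⟨k, hk.1⟩, k, hk.2⟩⟩
      by_cases hne : S.Nonempty
      · exact csSup_of_not_bddAbove (fun h => hS ⟨hne, h⟩) |>.trans (by simp)
      · rw [Set.not_nonempty_iff_eq_empty.1 hne]; simp
  · rintro (h | ⟨rfl, h⟩)
    · exact h1 n h
    · by_cases hS : S.Nonempty ∧ BddAbove S
      · exact absurd ⟨Nat.sSup_mem hS.1 hS.2, fun m hm => le_csSup hS.2 hm⟩ (h _)
      · by_cases hne : S.Nonempty
        · exact csSup_of_not_bddAbove (fun h => hS ⟨hne, h⟩) |>.trans (by simp)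
        · rw [Set.not_nonempty_iff_eq_empty.1 hne]; simp

lemma measurable_jumpCount (hU : IsDoubleWell U x₀ x₁ x₂) (hε : 0 < ε) (z : State) (t : ℝ) :
    Measurable fun e : ℕ → ℝ => jumpCount U ε z e t := by
  have hS : ∀ n, MeasurableSet {e : ℕ → ℝ | (jumpChain U ε z e n).1 ≤ t} := fun n =>
    measurableSet_le (hU.measurable_jumpChain hε z n).fst measurable_const
  have hG : ∀ n, MeasurableSet {e : ℕ → ℝ | (jumpChain U ε z e n).1 ≤ t ∧
      ∀ m, (jumpChain U ε z e m).1 ≤ t → m ≤ n} := by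
    intro n
    have h : MeasurableSet {e : ℕ → ℝ | ∀ m, (jumpChain U ε z e m).1 ≤ t → m ≤ n} := by
      simp only [Set.ofPred_forall]
      exact MeasurableSet.iInter fun m => (hS m).imp (MeasurableSet.const _)
    exact (hS n).inter h
  refine measurable_to_countable' fun n => ?_
  have : (fun e : ℕ → ℝ => jumpCount U ε z e t) ⁻¹' {n} =
      {e | (jumpChain U ε z e n).1 ≤ t ∧ ∀ m, (jumpChain U ε z e m).1 ≤ t → m ≤ n} ∪
      {e | n = 0 ∧ ∀ k, ¬ ((jumpChain U ε z e k).1 ≤ t ∧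
        ∀ m, (jumpChain U ε z e m).1 ≤ t → m ≤ k)} := by
    ext e
    exact nat_sSup_eq_iff _ n
  rw [this]
  have h : MeasurableSet {e : ℕ → ℝ | ∀ k, ¬ ((jumpChain U ε z e k).1 ≤ t ∧
      ∀ m, (jumpChain U ε z e m).1 ≤ t → m ≤ k)} := by
    simp only [Set.ofPred_forall]
    exact MeasurableSet.iInter fun k => (hG k).compl
  exact (hG n).union ((MeasurableSet.const _).inter h)

lemma measurable_path (hU : IsDoubleWell U x₀ x₁ x₂) (hε : 0 < ε) (z : State) (t : ℝ) :
    Measurable fun e : ℕ → ℝ => path U ε z e t := by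
  have h : Measurable fun p : ℕ × (ℕ → ℝ) => jumpChain U ε z p.2 p.1 :=
    measurable_from_prod_countable_right fun n => hU.measurable_jumpChain hε z n
  have h' : Measurable fun e : ℕ → ℝ => jumpChain U ε z e (jumpCount U ε z e t) :=
    h.comp ((hU.measurable_jumpCount hε z t).prodMk measurable_id)
  have hv : Measurable fun e : ℕ → ℝ => vel (jumpChain U ε z e (jumpCount U ε z e t)).2.2 :=
    (measurable_of_countable vel).comp h'.snd.snd
  exact (h'.snd.fst.add (hv.mul (measurable_const.sub h'.fst))).prodMk h'.snd.snd

end IsDoubleWell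

end

/-! ### Excursions from `x₀` and the hitting time of `x₁` -/

section

/-- The duration of an excursion from `x₀` and back, with velocity `-1` (driven by the clock `e₀`)
and then `1` (driven by `e₁`), the second half being truncated when the position is `x₁`. -/
def cycleTime (U : ℝ → ℝ) (ε x₀ x₁ e₀ e₁ : ℝ) : ℝ :=
  2 * holdingTime U ε (x₀, -1) e₀ + 2 * min (holdingTime U ε (x₀, 1) e₁) (x₁ - x₀)

/-- The total duration of the first `k` excursions. -/
def cycleSum (U : ℝ → ℝ) (ε x₀ x₁ : ℝ) (e : ℕ → ℝ) (k : ℕ) : ℝ :=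
  ∑ j ∈ Finset.range k, cycleTime U ε x₀ x₁ (e (2 * j)) (e (2 * j + 1))

namespace IsDoubleWell

variable {U : ℝ → ℝ} {x₀ x₁ x₂ ε : ℝ} {e : ℕ → ℝ} {n k : ℕ}

lemma cycleTime_nonneg (hU : IsDoubleWell U x₀ x₁ x₂) (hε : 0 < ε) (e₀ e₁ : ℝ) :
    0 ≤ cycleTime U ε x₀ x₁ e₀ e₁ := by
  have h1 := hU.holdingTime_nonneg hε (x₀, -1) e₀
  have h2 := le_min (hU.holdingTime_nonneg hε (x₀, 1) e₁) (sub_nonneg.2 hU.lt_left.le)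
  unfold cycleTime
  linarith

lemma jumpChain_succ (hU : IsDoubleWell U x₀ x₁ x₂) (hε : 0 < ε) {z : State} {s x : ℝ} {y : ℤˣ}
    (h : jumpChain U ε z e n = (s, (x, y))) :
    jumpChain U ε z e (n + 1) = (s + holdingTime U ε (x, y) (e n),
      (x + vel y * holdingTime U ε (x, y) (e n), -y)) := by
  simp only [jumpChain, h, hU.nextJumpTime_eq hε, add_sub_cancel_left]

lemma strictMono_jumpTime (hU : IsDoubleWell U x₀ x₁ x₂) (hε : 0 < ε) (he : ∀ n, 0 < e n)
    (z : State) : StrictMono fun n => (jumpChain U ε z e n).1 := by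
  refine strictMono_nat_of_lt_succ fun n => ?_
  rw [hU.jumpChain_succ hε (s := (jumpChain U ε z e n).1) (x := (jumpChain U ε z e n).2.1)
    (y := (jumpChain U ε z e n).2.2) rfl]
  exact lt_add_of_pos_right _ (hU.holdingTime_pos hε _ (he n))

lemma jumpCount_eq (hU : IsDoubleWell U x₀ x₁ x₂) (hε : 0 < ε) (he : ∀ n, 0 < e n)
    {z : State} {t : ℝ} (h1 : (jumpChain U ε z e n).1 ≤ t)
    (h2 : t < (jumpChain U ε z e (n + 1)).1) : jumpCount U ε z e t = n := by
  refine IsGreatest.csSup_eq ⟨h1, fun m hm => ?_⟩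
  by_contra! hcon
  have := (hU.strictMono_jumpTime hε he z).monotone (Nat.succ_le_of_lt hcon)
  simp only [Set.mem_ofPred_eq] at hm
  simp only [Nat.succ_eq_add_one] at this
  linarith

lemma path_eq (hU : IsDoubleWell U x₀ x₁ x₂) (hε : 0 < ε) (he : ∀ n, 0 < e n)
    {z : State} {t s x : ℝ} {y : ℤˣ} (h : jumpChain U ε z e n = (s, (x, y))) (h1 : s ≤ t)
    (h2 : t < (jumpChain U ε z e (n + 1)).1) :
    path U ε z e t = (x + vel y * (t - s), y) := by
  simp only [path, hU.jumpCount_eq hε he (n := n) (by rw [h]; exact h1) h2, h]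

/-- Here `d` is the distance to the right of `x₀` at which cycle `k` begins. A cycle is counted from
one passage at `x₀` to the next such return, so the jump at `x₀ + d` happens `d` before the time
`cycleSum`. -/
lemma jumpChain_cycle (hU : IsDoubleWell U x₀ x₁ x₂) (hε : 0 < ε) (he : ∀ n, 0 < e n)
    (h : ∀ j < k, holdingTime U ε (x₀, 1) (e (2 * j + 1)) < x₁ - x₀) :
    ∃ d, 0 ≤ d ∧ d < x₁ - x₀ ∧
      jumpChain U ε (x₀, -1) e (2 * k) = (cycleSum U ε x₀ x₁ e k - d, (x₀ + d, -1)) ∧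
      jumpChain U ε (x₀, -1) e (2 * k + 1) =
        (cycleSum U ε x₀ x₁ e k + holdingTime U ε (x₀, -1) (e (2 * k)),
          (x₀ - holdingTime U ε (x₀, -1) (e (2 * k)), 1)) ∧
      jumpChain U ε (x₀, -1) e (2 * k + 1 + 1) =
        (cycleSum U ε x₀ x₁ e k + 2 * holdingTime U ε (x₀, -1) (e (2 * k)) +
          holdingTime U ε (x₀, 1) (e (2 * k + 1)),
          (x₀ + holdingTime U ε (x₀, 1) (e (2 * k + 1)), -1)) := by
  have step : ∀ k d, 0 ≤ d → d < x₁ - x₀ →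
      jumpChain U ε (x₀, -1) e (2 * k) = (cycleSum U ε x₀ x₁ e k - d, (x₀ + d, -1)) →
      jumpChain U ε (x₀, -1) e (2 * k + 1) =
        (cycleSum U ε x₀ x₁ e k + holdingTime U ε (x₀, -1) (e (2 * k)),
          (x₀ - holdingTime U ε (x₀, -1) (e (2 * k)), 1)) ∧
      jumpChain U ε (x₀, -1) e (2 * k + 1 + 1) =
        (cycleSum U ε x₀ x₁ e k + 2 * holdingTime U ε (x₀, -1) (e (2 * k)) +
          holdingTime U ε (x₀, 1) (e (2 * k + 1)),
          (x₀ + holdingTime U ε (x₀, 1) (e (2 * k + 1)), -1)) := by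
    intro k d hd hd' hk
    have h1 : jumpChain U ε (x₀, -1) e (2 * k + 1) =
        (cycleSum U ε x₀ x₁ e k + holdingTime U ε (x₀, -1) (e (2 * k)),
          (x₀ - holdingTime U ε (x₀, -1) (e (2 * k)), 1)) := by
      rw [hU.jumpChain_succ hε hk, hU.holdingTime_left hε (he _) hd hd'.le]
      simp only [vel_neg, vel_one, neg_neg, Prod.mk.injEq, and_true]
      constructor <;> ring
    refine ⟨h1, ?_⟩
    rw [hU.jumpChain_succ hε h1, hU.holdingTime_right hε (he _) (hU.holdingTime_nonneg hε _ _)]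
    simp only [vel_one, Prod.mk.injEq, and_true]
    constructor <;> ring
  have main : ∃ d, 0 ≤ d ∧ d < x₁ - x₀ ∧
      jumpChain U ε (x₀, -1) e (2 * k) = (cycleSum U ε x₀ x₁ e k - d, (x₀ + d, -1)) := by
    induction k with
    | zero => exact ⟨0, le_rfl, sub_pos.2 hU.lt_left, by simp [cycleSum, jumpChain]⟩
    | succ k ih =>
      obtain ⟨d, hd, hd', hk⟩ := ih fun j hj => h j (by omega)
      refine ⟨holdingTime U ε (x₀, 1) (e (2 * k + 1)), hU.holdingTime_nonneg hε _ _,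
        h k (by omega), ?_⟩
      rw [show 2 * (k + 1) = 2 * k + 1 + 1 by ring, (step k d hd hd' hk).2]
      simp only [cycleSum, Finset.sum_range_succ, cycleTime, Prod.mk.injEq, and_true]
      rw [min_eq_left (h k (by omega)).le]
      ring
  obtain ⟨d, hd, hd', hk⟩ := main
  exact ⟨d, hd, hd', hk, step k d hd hd' hk⟩

/-- Before the first successful excursion is over, the position is on the left of `x₁`. -/
lemma path_fst_lt (hU : IsDoubleWell U x₀ x₁ x₂) (hε : 0 < ε) (he : ∀ n, 0 < e n)
    (h : ∀ j < n, holdingTime U ε (x₀, 1) (e (2 * j + 1)) < x₁ - x₀)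
    (hn : x₁ - x₀ ≤ holdingTime U ε (x₀, 1) (e (2 * n + 1))) {t : ℝ} (ht : 0 ≤ t)
    (ht' : t < cycleSum U ε x₀ x₁ e (n + 1) - (x₁ - x₀)) :
    (path U ε (x₀, -1) e t).1 < x₁ := by
  -- The truncated right half contributes `2 * (x₁ - x₀)`; removing the way back leaves the instant
  -- at which `x₁` is reached.
  have hS : cycleSum U ε x₀ x₁ e (n + 1) - (x₁ - x₀) = cycleSum U ε x₀ x₁ e n +
      2 * holdingTime U ε (x₀, -1) (e (2 * n)) + (x₁ - x₀) := by
    simp only [cycleSum, Finset.sum_range_succ, cycleTime, min_eq_right hn]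
    ring
  rw [hS] at ht'
  have hlast : t < (jumpChain U ε (x₀, -1) e (2 * n + 1 + 1)).1 := by
    obtain ⟨d, -, -, -, -, h2⟩ := hU.jumpChain_cycle hε he h
    rw [h2]
    simp only
    linarith
  -- The least such `m` is the flight in progress at time `t`. Its parity tells whether the velocity
  -- is `-1` (even) or `1` (odd).
  have hex : ∃ m, t < (jumpChain U ε (x₀, -1) e (m + 1)).1 := ⟨_, hlast⟩
  classical
  have hm := Nat.find_spec hex
  have hmn : Nat.find hex ≤ 2 * n + 1 := Nat.find_min' hex hlast
  have hmin : ∀ i < Nat.find hex, ¬ t < (jumpChain U ε (x₀, -1) e (i + 1)).1 :=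
    fun i hi => Nat.find_min hex hi
  set m := Nat.find hex
  have hlow : (jumpChain U ε (x₀, -1) e m).1 ≤ t := by
    rcases Nat.eq_zero_or_pos m with h0 | h0
    · rw [h0]; simpa [jumpChain] using ht
    · have := hmin (m - 1) (by omega)
      rwa [Nat.sub_add_cancel h0, not_lt] at this
  obtain ⟨k, hk | hk⟩ := Nat.even_or_odd' m
  · obtain ⟨d, hd, hd', h0, -, -⟩ := hU.jumpChain_cycle (k := k) hε he fun j hj => h j (by omega)
    rw [hk] at hm hlow
    rw [h0] at hlow
    rw [hU.path_eq hε he h0 hlow hm]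
    simp only [vel_neg, vel_one] at hlow ⊢
    linarith
  · obtain ⟨d, hd, hd', -, h1, h2⟩ := hU.jumpChain_cycle (k := k) hε he fun j hj => h j (by omega)
    rw [hk] at hm hlow
    rw [h1] at hlow
    rw [hU.path_eq hε he h1 hlow hm]
    rw [h2] at hm
    simp only [vel_one] at hlow hm ⊢
    rcases lt_or_eq_of_le (show k ≤ n by omega) with hkn | rfl
    · have := h k hkn
      linarith
    · linarith

lemma path_fst_eq (hU : IsDoubleWell U x₀ x₁ x₂) (hε : 0 < ε) (he : ∀ n, 0 < e n)
    (h : ∀ j < n, holdingTime U ε (x₀, 1) (e (2 * j + 1)) < x₁ - x₀)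
    (hn : x₁ - x₀ ≤ holdingTime U ε (x₀, 1) (e (2 * n + 1))) :
    (path U ε (x₀, -1) e (cycleSum U ε x₀ x₁ e (n + 1) - (x₁ - x₀))).1 = x₁ := by
  have hS : cycleSum U ε x₀ x₁ e (n + 1) - (x₁ - x₀) = cycleSum U ε x₀ x₁ e n +
      2 * holdingTime U ε (x₀, -1) (e (2 * n)) + (x₁ - x₀) := by
    simp only [cycleSum, Finset.sum_range_succ, cycleTime, min_eq_right hn]
    ring
  have h01 := hU.lt_left
  obtain ⟨d, hd, hd', -, h1, h2⟩ := hU.jumpChain_cycle hε he h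
  have hpos := hU.holdingTime_nonneg hε (x₀, -1) (e (2 * n))
  rw [hS]
  -- If the jump occurs exactly at `x₁`, the position at that instant is read off at the start of
  -- the next flight, since paths are right-continuous.
  rcases hn.lt_or_eq with hlt | heq
  · rw [hU.path_eq hε he h1 (by linarith) (by rw [h2]; simp only; linarith)]
    simp only [vel_one]
    ring
  · rw [hU.path_eq hε he h2 (by linarith) ?_]
    · simp only [vel_neg, vel_one]
      linarith
    · have := hU.strictMono_jumpTime hε he (x₀, -1) (Nat.lt_succ_self (2 * n + 1 + 1))
      simp only [Nat.succ_eq_add_one] at this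
      rw [h2] at this
      simp only at this
      linarith

/-- The hitting time of `x₁` in terms of the excursions from `x₀`. -/
lemma hittingTime_eq (hU : IsDoubleWell U x₀ x₁ x₂) (hε : 0 < ε) (he : ∀ n, 0 < e n)
    (h : ∀ j < n, holdingTime U ε (x₀, 1) (e (2 * j + 1)) < x₁ - x₀)
    (hn : x₁ - x₀ ≤ holdingTime U ε (x₀, 1) (e (2 * n + 1))) :
    hittingTime U ε (x₀, -1) x₁ e = cycleSum U ε x₀ x₁ e (n + 1) - (x₁ - x₀) := by
  refine IsLeast.csInf_eq ⟨⟨?_, hU.path_fst_eq hε he h hn⟩, fun t ht => ?_⟩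
  · have h01 := hU.lt_left
    have hs : 0 ≤ cycleSum U ε x₀ x₁ e n :=
      Finset.sum_nonneg fun j _ => hU.cycleTime_nonneg hε _ _
    have ha := hU.holdingTime_nonneg hε (x₀, -1) (e (2 * n))
    rw [cycleSum, Finset.sum_range_succ, cycleTime, min_eq_right hn]
    rw [cycleSum] at hs
    linarith
  · by_contra! hcon
    exact (hU.path_fst_lt hε he h hn ht.1.le hcon).ne ht.2

end IsDoubleWell

end

/-! ### Exponential variables and independence -/

section

instance : IsProbabilityMeasure (expMeasure 1) := isProbabilityMeasure_expMeasure one_pos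

lemma expMeasure_real_Ioi {a : ℝ} (ha : 0 ≤ a) :
    (expMeasure 1).real (Set.Ioi a) = Real.exp (-a) := by
  have h := cdf_expMeasure_eq one_pos a
  rw [cdf_eq_real, if_pos ha, one_mul] at h
  rw [← Set.compl_Iic, probReal_compl_eq_one_sub measurableSet_Iic, h]
  ring

lemma ae_pos_expMeasure : ∀ᵐ x ∂(expMeasure 1), 0 < x := by
  have h := expMeasure_real_Ioi le_rfl
  rw [neg_zero, Real.exp_zero] at h
  have h2 := (prob_compl_eq_zero_iff (μ := expMeasure 1) (measurableSet_Ioi (a := (0 : ℝ)))).2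
    (by rw [← ENNReal.toReal_eq_one_iff]; exact h)
  exact h2

lemma memLp_id_expMeasure : MemLp (fun x : ℝ => x) 2 (expMeasure 1) := by
  rw [memLp_two_iff_integrable_sq (by fun_prop)]
  refine ⟨by fun_prop, ?_⟩
  rw [hasFiniteIntegral_iff_enorm]
  have hle : ∀ x : ℝ, exponentialPDF 1 x * ‖x ^ 2‖ₑ ≤
      ENNReal.ofReal ((Set.Ioi (-1 : ℝ)).indicator (fun x => 8 * Real.exp (-(1 / 2) * x)) x) := by
    intro x
    rcases lt_or_ge x 0 with h | h
    · rw [exponentialPDF_of_neg h, zero_mul]; exact zero_le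
    · rw [exponentialPDF_of_nonneg h, Set.indicator_of_mem (Set.mem_Ioi.2 (by linarith)),
        Real.enorm_eq_ofReal (by positivity), ← ENNReal.ofReal_mul (by positivity)]
      apply ENNReal.ofReal_le_ofReal
      -- The quadratic term of the exponential at `x / 2` gives `x ^ 2 ≤ 8 * exp (x / 2)`, which
      -- leaves half of the exponential decay.
      have h1 := Real.quadratic_le_exp_of_nonneg (show 0 ≤ x / 2 by positivity)
      have h2 : Real.exp (-(1 / 2) * x) = Real.exp (-(1 * x)) * Real.exp (x / 2) := by
        rw [← Real.exp_add]; ring_nf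
      rw [h2]
      have h3 := Real.exp_pos (-(1 * x))
      have h4 : x ^ 2 ≤ 8 * Real.exp (x / 2) := by nlinarith
      nlinarith [mul_le_mul_of_nonneg_left h4 h3.le]
  have hint : Integrable ((Set.Ioi (-1 : ℝ)).indicator (fun x => 8 * Real.exp (-(1 / 2) * x))) :=
    IntegrableOn.integrable_indicator
      ((exp_neg_integrableOn_Ioi (-1) (by norm_num)).const_mul 8) measurableSet_Ioi
  have hm : expMeasure 1 = volume.withDensity (exponentialPDF 1) := rfl
  rw [hm, lintegral_withDensity_eq_lintegral_mul _
    (show Measurable (exponentialPDF 1) from (measurable_exponentialPDFReal 1).ennreal_ofReal)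
    (by fun_prop)]
  refine (lintegral_mono hle).trans_lt ?_
  have := hint.hasFiniteIntegral
  rw [hasFiniteIntegral_iff_ofReal (Eventually.of_forall fun x =>
    Set.indicator_nonneg (fun _ _ => by positivity) _)] at this
  exact this

variable {Ω : Type*} [MeasurableSpace Ω] {P : Measure Ω} {E : ℕ → Ω → ℝ} {μ : Measure ℝ}

/-- An alternating sum of functions of i.i.d. variables satisfies Chebyshev's inequality. -/
lemma measureReal_sum_le [IsProbabilityMeasure P] [IsProbabilityMeasure μ]
    (hE_law : ∀ k, HasLaw (E k) μ P) (hE_indep : iIndepFun E P)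
    {A B : ℝ → ℝ} (hA : Measurable A) (hB : Measurable B) (hA2 : MemLp A 2 μ) (hB2 : MemLp B 2 μ)
    (n : ℕ) {s : ℝ} (hs : s < n * (∫ x, A x ∂μ + ∫ x, B x ∂μ)) :
    P.real {ω | ∑ j ∈ Finset.range n, (A (E (2 * j) ω) + B (E (2 * j + 1) ω)) ≤ s} ≤
      n * (Var[A; μ] + Var[B; μ]) / (n * (∫ x, A x ∂μ + ∫ x, B x ∂μ) - s) ^ 2 := by
  have hm : ∀ k, AEMeasurable (E k) P := fun k => (hE_law k).aemeasurable
  have hAm : ∀ k, MemLp (A ∘ E k) 2 P := fun k =>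
    MemLp.comp_of_map (by rw [(hE_law k).map_eq]; exact hA2) (hm k)
  have hBm : ∀ k, MemLp (B ∘ E k) 2 P := fun k =>
    MemLp.comp_of_map (by rw [(hE_law k).map_eq]; exact hB2) (hm k)
  have hAi : ∀ k, P[A ∘ E k] = ∫ x, A x ∂μ := fun k => (hE_law k).integral_comp hA2.1
  have hBi : ∀ k, P[B ∘ E k] = ∫ x, B x ∂μ := fun k => (hE_law k).integral_comp hB2.1
  have hvar : ∀ k {A : ℝ → ℝ}, Measurable A → Var[A ∘ E k; P] = Var[A; μ] := by
    intro k A hA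
    rw [← (hE_law k).map_eq, variance_map hA.aemeasurable (hm k)]
  set X : ℕ → Ω → ℝ := fun j => A ∘ E (2 * j) + B ∘ E (2 * j + 1) with hX
  have hX2 : ∀ j, MemLp (X j) 2 P := fun j => (hAm _).add (hBm _)
  have hXi : ∀ j, P[X j] = ∫ x, A x ∂μ + ∫ x, B x ∂μ := by
    intro j
    rw [← hAi (2 * j), ← hBi (2 * j + 1)]
    exact integral_add ((hAm _).integrable (by norm_num)) ((hBm _).integrable (by norm_num))
  have hXv : ∀ j, Var[X j; P] = Var[A; μ] + Var[B; μ] := by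
    intro j
    rw [hX, IndepFun.variance_add (hAm _) (hBm _)
      ((hE_indep.indepFun (by omega)).comp hA hB), hvar _ hA, hvar _ hB]
  have hsum2 : MemLp (∑ j ∈ Finset.range n, X j) 2 P := memLp_finsetSum' _ fun j _ => hX2 j
  have hsi : P[∑ j ∈ Finset.range n, X j] = n * (∫ x, A x ∂μ + ∫ x, B x ∂μ) := by
    simp only [Finset.sum_apply]
    rw [integral_finsetSum _ fun j _ => (hX2 j).integrable (by norm_num)]
    simp only [hXi, Finset.sum_const, Finset.card_range, nsmul_eq_mul]
  have hsv : Var[∑ j ∈ Finset.range n, X j; P] = n * (Var[A; μ] + Var[B; μ]) := by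
    rw [IndepFun.variance_sum (fun j _ => hX2 j) fun i _ j _ hij => ?_]
    · simp only [hXv, Finset.sum_const, Finset.card_range, nsmul_eq_mul]
    -- Distinct summands use disjoint pairs of clocks.
    · exact (hE_indep.indepFun_prodMk_prodMk₀ hm (2 * i) (2 * i + 1) (2 * j) (2 * j + 1)
        (by omega) (by omega) (by omega) (by omega)).comp
        (φ := fun p : ℝ × ℝ => A p.1 + B p.2) (ψ := fun p : ℝ × ℝ => A p.1 + B p.2)
        (by fun_prop) (by fun_prop)
  have hc := meas_ge_le_variance_div_sq hsum2 (sub_pos.2 hs)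
  rw [hsi, hsv] at hc
  have hnn : 0 ≤ n * (Var[A; μ] + Var[B; μ]) := by
    have := variance_nonneg A μ
    have := variance_nonneg B μ
    positivity
  refine ENNReal.toReal_le_of_le_ofReal (by positivity) (le_trans (measure_mono fun ω hω => ?_) hc)
  have hω' : ∑ j ∈ Finset.range n, (A (E (2 * j) ω) + B (E (2 * j + 1) ω)) ≤ s := hω
  simp only [Set.mem_ofPred_eq, Finset.sum_apply, hX, Pi.add_apply, Function.comp_apply]
  rw [abs_sub_comm]
  exact le_trans (by linarith) (le_abs_self _)

lemma measure_forall_lt (hE_law : ∀ k, HasLaw (E k) μ P) (hE_indep : iIndepFun E P) {F : Set ℝ}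
    (hF : MeasurableSet F) (k : ℕ) : P {ω | ∀ j < k, E (2 * j + 1) ω ∈ F} = μ F ^ k := by
  have hinj : Function.Injective fun j : ℕ => 2 * j + 1 := fun a b h => by
    simp only at h; omega
  have h := (hE_indep.precomp hinj).measure_inter_preimage_eq_mul (Finset.range k)
    (sets := fun _ => F) (fun _ _ => hF)
  have h2 : ∀ i, P (E (2 * i + 1) ⁻¹' F) = μ F := fun i => by
    rw [← (hE_law (2 * i + 1)).map_eq, Measure.map_apply_of_aemeasurable
      (hE_law _).aemeasurable hF]
  simp only [h2, Finset.prod_const, Finset.card_range] at h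
  rw [← h]
  congr 1
  ext ω
  simp

/-- The event involves only clocks of index below `2 * k`, hence is independent of clock `m`. This
factorizes each term in Wald's identity. -/
lemma lintegral_indicator_mul_comp (hE_law : ∀ k, HasLaw (E k) μ P) (hE_indep : iIndepFun E P)
    {F : Set ℝ} (hF : MeasurableSet F) {f : ℝ → ENNReal} (hf : Measurable f) {k m : ℕ}
    (hkm : 2 * k ≤ m) :
    ∫⁻ ω, {ω | ∀ j < k, E (2 * j + 1) ω ∈ F}.indicator 1 ω * f (E m ω) ∂P =
      μ F ^ k * ∫⁻ x, f x ∂μ := by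
  have hm : ∀ k, AEMeasurable (E k) P := fun k => (hE_law k).aemeasurable
  have hind := hE_indep.indepFun_finset₀ (Finset.range (2 * k)) {m}
    (by simpa using hkm) hm
  set G : Set (Finset.range (2 * k) → ℝ) :=
    {x | ∀ j (hj : j < k), x ⟨2 * j + 1, by simp; omega⟩ ∈ F} with hG
  have hGm : MeasurableSet G := by
    simp only [hG, Set.ofPred_forall]
    exact MeasurableSet.iInter fun j => MeasurableSet.iInter fun hj =>
      (measurable_pi_apply _) hF
  have h2 := hind.comp (φ := G.indicator (1 : (Finset.range (2 * k) → ℝ) → ENNReal))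
    (ψ := fun x : ({m} : Finset ℕ) → ℝ => f (x ⟨m, by simp⟩))
    (measurable_one.indicator hGm) (hf.comp (measurable_pi_apply _))
  have hset : MeasurableSet {x : ℕ → ℝ | ∀ j < k, x (2 * j + 1) ∈ F} := by
    simp only [Set.ofPred_forall]
    exact MeasurableSet.iInter fun j => MeasurableSet.iInter fun hj => (measurable_pi_apply _) hF
  have hnull : NullMeasurableSet {ω | ∀ j < k, E (2 * j + 1) ω ∈ F} P :=
    (aemeasurable_pi_lambda (fun ω k => E k ω) hm).nullMeasurableSet_preimage hset
  have h3 : (G.indicator (1 : (Finset.range (2 * k) → ℝ) → ENNReal)) ∘ (fun a (i : Finset.range (2 * k)) => E i a) =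
      {ω | ∀ j < k, E (2 * j + 1) ω ∈ F}.indicator 1 := by
    ext ω
    simp [Set.indicator, hG]
  rw [h3] at h2
  have hi : AEMeasurable ({ω | ∀ j < k, E (2 * j + 1) ω ∈ F}.indicator (1 : Ω → ENNReal)) P :=
    aemeasurable_one.indicator₀ hnull
  have h4 := lintegral_mul_eq_lintegral_mul_lintegral_of_indepFun'
    hi (hf.comp_aemeasurable (hm m)) h2
  refine h4.trans ?_
  rw [lintegral_indicator_one₀ hnull, measure_forall_lt hE_law hE_indep hF]
  congr 1
  exact (hE_law m).lintegral_comp hf.aemeasurable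

end

/-! ### Measures on the state space and their slices -/

/-- The restriction of a measure on the state space to the states of velocity `y`. -/
def slice (μ : Measure State) (y : ℤˣ) : Measure ℝ := μ.comap fun x => (x, y)

lemma measurableEmbedding_mk (y : ℤˣ) : MeasurableEmbedding fun x : ℝ => ((x, y) : State) :=
  measurableEmbedding_prod_mk_right y

lemma slice_apply (μ : Measure State) (y : ℤˣ) (s : Set ℝ) :
    slice μ y s = μ (s ×ˢ {y}) := by
  rw [slice, (measurableEmbedding_mk y).comap_apply]
  congr 1
  ext ⟨x, y'⟩
  simp [eq_comm]

instance (μ : Measure State) [IsFiniteMeasure μ] (y : ℤˣ) : IsFiniteMeasure (slice μ y) :=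
  ⟨by rw [slice_apply]; exact measure_lt_top _ _⟩

lemma map_slice_add_map_slice (μ : Measure State) :
    (slice μ 1).map (fun x => (x, 1)) + (slice μ (-1)).map (fun x => (x, -1)) = μ := by
  have hr : ∀ y : ℤˣ, Set.range (fun x : ℝ => ((x, y) : State)) = {z | z.2 = y} := by
    intro y
    ext ⟨x, y'⟩
    simp [eq_comm]
  rw [slice, slice, (measurableEmbedding_mk 1).map_comap, (measurableEmbedding_mk (-1)).map_comap,
    ← Measure.restrict_union _ (measurableEmbedding_mk (-1)).measurableSet_range, hr, hr]
  · convert Measure.restrict_univ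
    ext z
    simpa using Int.units_eq_one_or z.2
  · rw [hr, hr, Set.disjoint_left]
    rintro z (hz : z.2 = 1) (hz' : z.2 = -1)
    rw [hz] at hz'
    exact absurd hz' (by decide)

lemma integral_eq_slice {μ : Measure State} {F : State → ℝ}
    (h : ∀ y, Integrable (fun x => F (x, y)) (slice μ y)) :
    ∫ z, F z ∂μ = ∫ x, F (x, 1) ∂(slice μ 1) + ∫ x, F (x, -1) ∂(slice μ (-1)) := by
  conv_lhs => rw [← map_slice_add_map_slice μ]
  rw [integral_add_measure, (measurableEmbedding_mk 1).integral_map,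
    (measurableEmbedding_mk (-1)).integral_map]
  · exact (measurableEmbedding_mk 1).integrable_map_iff.2 (h 1)
  · exact (measurableEmbedding_mk (-1)).integrable_map_iff.2 (h (-1))

instance : Nonempty ℤˣ := ⟨1⟩

lemma uniformOn_units (y : ℤˣ) : uniformOn (Set.univ : Set ℤˣ) {y} = 2⁻¹ := by
  rw [uniformOn_univ]
  simp

lemma slice_gibbs (U : ℝ → ℝ) (ε : ℝ) (y : ℤˣ) :
    slice (gibbs U ε) y = (2⁻¹ : ENNReal) • (volume : Measure ℝ).tilted (fun x => -U x / ε) := by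
  ext s hs
  have : IsProbabilityMeasure (uniformOn (Set.univ : Set ℤˣ)) :=
    isProbabilityMeasure_uniformOn Set.finite_univ Set.univ_nonempty
  rw [slice_apply, gibbs, Measure.prod_prod, uniformOn_units, Measure.smul_apply, smul_eq_mul,
    mul_comm]

/-! ### Test functions -/

/-- A primitive of `x ↦ φ (x + a) - φ x`. -/
lemma exists_primitive_shift {φ : ℝ → ℝ} (hφ : Continuous φ) (hc : HasCompactSupport φ) (a : ℝ) :
    ∃ g : ℝ → ℝ, ContDiff ℝ 1 g ∧ HasCompactSupport g ∧ ∀ x, deriv g x = φ (x + a) - φ x := by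
  have hd : ∀ x, HasDerivAt (fun x => ∫ r in x..x + a, φ r) (φ (x + a) - φ x) x := by
    intro x
    have h1 : HasDerivAt (fun x => ∫ r in (0 : ℝ)..x, φ r) (φ x) x :=
      hφ.integral_hasStrictDerivAt 0 x |>.hasDerivAt
    have h2 : HasDerivAt (fun x => ∫ r in (0 : ℝ)..x + a, φ r) (φ (x + a)) x :=
      (hφ.integral_hasStrictDerivAt 0 (x + a) |>.hasDerivAt).comp_add_const x a
    convert! h2.sub h1 using 1
    ext y
    simp only [Pi.sub_apply]
    rw [intervalIntegral.integral_interval_sub_left (hφ.intervalIntegrable _ _)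
      (hφ.intervalIntegrable _ _)]
  -- The integral of `φ` over a sliding window vanishes once the window leaves the support.
  refine ⟨fun x => ∫ r in x..x + a, φ r, ?_, ?_, fun x => (hd x).deriv⟩
  · rw [contDiff_one_iff_deriv]
    refine ⟨fun x => (hd x).differentiableAt, ?_⟩
    rw [show deriv (fun x => ∫ r in x..x + a, φ r) = fun x => φ (x + a) - φ x from
      funext fun x => (hd x).deriv]
    fun_prop
  · obtain ⟨R, hR⟩ := hc.isCompact.isBounded.subset_closedBall 0
    refine HasCompactSupport.intro (isCompact_Icc (a := -(R + |a|)) (b := R + |a|)) fun x hx => ?_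
    rw [intervalIntegral.integral_congr (g := fun _ => 0), intervalIntegral.integral_zero]
    intro r hr
    by_contra hne
    have h1 := hR (subset_tsupport _ hne)
    rw [Metric.mem_closedBall, dist_zero_right, Real.norm_eq_abs, abs_le] at h1
    apply hx
    have h2 := Set.abs_sub_left_of_mem_uIcc hr
    rw [add_sub_cancel_left] at h2
    obtain ⟨h3, h4⟩ := abs_le.1 h2
    constructor <;> linarith [h1.1, h1.2]

lemma hasCompactSupport_shift {φ : ℝ → ℝ} (hc : HasCompactSupport φ) (a : ℝ) :
    HasCompactSupport fun x => φ (x + a) :=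
  hc.comp_homeomorph (Homeomorph.addRight a)

/-- The integral of a function of compact support against a finite measure tends to `0` along
translations. -/
lemma tendsto_integral_shift {φ : ℝ → ℝ} (hφ : Continuous φ) (hc : HasCompactSupport φ)
    (ρ : Measure ℝ) [IsFiniteMeasure ρ] :
    Tendsto (fun a => ∫ x, φ (x + a) ∂ρ) atTop (𝓝 0) := by
  obtain ⟨C, hC⟩ := hc.exists_bound_of_continuous hφ
  have h := tendsto_integral_filter_of_dominated_convergence (μ := ρ) (l := atTop)
    (F := fun a x => φ (x + a)) (f := fun _ => 0) (fun _ => C)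
    (Eventually.of_forall fun a => Continuous.aestronglyMeasurable (by fun_prop))
    (Eventually.of_forall fun a => Eventually.of_forall fun x => hC _)
    (integrable_const C) (Eventually.of_forall fun x => ?_)
  · simpa using h
  · have h0 : Tendsto φ atTop (𝓝 0) := by
      exact (hc.is_zero_at_infty).mono_left atTop_le_cocompact
    exact h0.comp (tendsto_atTop_add_const_left _ _ tendsto_id)

lemma ext_of_integral {ρ ρ' : Measure ℝ} [IsLocallyFiniteMeasure ρ] [IsLocallyFiniteMeasure ρ']
    (h : ∀ φ : ℝ → ℝ, Continuous φ → HasCompactSupport φ → ∫ x, φ x ∂ρ = ∫ x, φ x ∂ρ') :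
    ρ = ρ' :=
  Measure.ext_of_integral_eq_on_compactlySupported fun f => h f f.continuous f.hasCompactSupport

/-- Two finite measures with the same integrals of derivatives of test functions are equal. -/
lemma eq_of_integral_deriv_eq {ρ ρ' : Measure ℝ} [IsFiniteMeasure ρ] [IsFiniteMeasure ρ']
    (h : ∀ g : ℝ → ℝ, ContDiff ℝ 1 g → HasCompactSupport g →
      ∫ x, deriv g x ∂ρ = ∫ x, deriv g x ∂ρ') : ρ = ρ' := by
  refine ext_of_integral fun φ hφ hc => ?_
  have hint : ∀ (ν : Measure ℝ) [IsFiniteMeasure ν] (a : ℝ), Integrable (fun x => φ (x + a)) ν :=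
    fun ν _ a => Continuous.integrable_of_hasCompactSupport (by fun_prop)
      (hasCompactSupport_shift hc a)
  have hint0 : ∀ (ν : Measure ℝ) [IsFiniteMeasure ν], Integrable φ ν := fun ν _ =>
    hφ.integrable_of_hasCompactSupport hc
  -- The difference of the two integrals does not change when `φ` is translated; yet it tends to `0`
  -- as `φ` escapes to infinity, so it is `0`.
  have key : ∀ a, ∫ x, φ (x + a) ∂ρ - ∫ x, φ (x + a) ∂ρ' = ∫ x, φ x ∂ρ - ∫ x, φ x ∂ρ' := by
    intro a
    obtain ⟨g, hg, hgc, hgd⟩ := exists_primitive_shift hφ hc a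
    have := h g hg hgc
    simp only [hgd] at this
    rw [integral_sub (hint ρ a) (hint0 ρ), integral_sub (hint ρ' a) (hint0 ρ')] at this
    linarith
  have h1 := (tendsto_integral_shift hφ hc ρ).sub (tendsto_integral_shift hφ hc ρ')
  simp only [key, sub_zero] at h1
  have := tendsto_nhds_unique tendsto_const_nhds h1
  linarith

/-- A locally finite measure which vanishes on derivatives of test functions is a multiple of the
Lebesgue measure. -/
lemma exists_eq_smul_volume {ν : Measure ℝ} [IsLocallyFiniteMeasure ν]
    (h : ∀ g : ℝ → ℝ, ContDiff ℝ 1 g → HasCompactSupport g → ∫ x, deriv g x ∂ν = 0) :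
    ∃ c : NNReal, ν = c • volume := by
  -- Increments `φ (x + a) - φ x` are derivatives of test functions, so `ν` is translation
  -- invariant, and uniqueness of Haar measure applies.
  have hinv : ν.IsAddLeftInvariant := by
    refine ⟨fun a => ?_⟩
    have : IsFiniteMeasureOnCompacts (ν.map (a + ·)) :=
      Measure.IsFiniteMeasureOnCompacts.map ν (Homeomorph.addLeft a)
    refine ext_of_integral fun φ hφ hc => ?_
    rw [integral_map (by fun_prop) hφ.aestronglyMeasurable]
    obtain ⟨g, hg, hgc, hgd⟩ := exists_primitive_shift hφ hc a
    have := h g hg hgc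
    simp only [hgd] at this
    rw [integral_sub (Continuous.integrable_of_hasCompactSupport (by fun_prop)
      (hasCompactSupport_shift hc a)) (hφ.integrable_of_hasCompactSupport hc)] at this
    simp only [add_comm a]
    linarith
  exact ⟨_, Measure.isAddLeftInvariant_eq_smul ν volume⟩

/-! ### Invariance and uniqueness of the Gibbs law -/

section

/-- Since `a₊ - (-a)₊ = a`, adding the generator over both velocities leaves only the drift term of
the Gibbs weight. -/
lemma jumpRate_sub_jumpRate (U : ℝ → ℝ) (ε x : ℝ) :
    jumpRate U ε x 1 - jumpRate U ε x (-1) = deriv U x / ε := by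
  simp only [jumpRate, vel_one, vel_neg, one_mul, neg_one_mul, ← sub_div]
  congr 1
  rcases le_total 0 (deriv U x) with h | h
  · rw [max_eq_left h, max_eq_right (by linarith), sub_zero]
  · rw [max_eq_right h, max_eq_left (by linarith)]; ring

namespace IsDoubleWell

variable {U : ℝ → ℝ} {x₀ x₁ x₂ ε : ℝ}

lemma isProbabilityMeasure_tilted (hU : IsDoubleWell U x₀ x₁ x₂) (hε : 0 < ε) :
    IsProbabilityMeasure ((volume : Measure ℝ).tilted (fun x => -U x / ε)) :=
  MeasureTheory.isProbabilityMeasure_tilted (hU.integrable_exp hε)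

lemma isProbabilityMeasure_gibbs (hU : IsDoubleWell U x₀ x₁ x₂) (hε : 0 < ε) :
    IsProbabilityMeasure (gibbs U ε) := by
  have := hU.isProbabilityMeasure_tilted hε
  have : IsProbabilityMeasure (uniformOn (Set.univ : Set ℤˣ)) :=
    isProbabilityMeasure_uniformOn Set.finite_univ Set.univ_nonempty
  unfold gibbs
  infer_instance

lemma integrable_generator (hU : IsDoubleWell U x₀ x₁ x₂) {f : State → ℝ}
    (hf : ∀ y, ContDiff ℝ 1 fun x => f (x, y)) (hc : ∀ y, HasCompactSupport fun x => f (x, y)) (ε : ℝ) (ρ : Measure ℝ)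
    [IsLocallyFiniteMeasure ρ] (y : ℤˣ) : Integrable (fun x => generator U ε f (x, y)) ρ := by
  have h1 : Continuous (deriv fun x => f (x, y)) := (hf y).continuous_deriv le_rfl
  have h2 := (hf y).continuous
  have h3 := (hf (-y)).continuous
  have h4 := hU.continuous_jumpRate ε y
  refine Continuous.integrable_of_hasCompactSupport ?_ ?_
  · change Continuous fun x => vel y * deriv (fun x => f (x, y)) x +
      jumpRate U ε x y * (f (x, -y) - f (x, y))
    exact (continuous_const.mul h1).add (h4.mul (h3.sub h2))
  · exact ((hc y).deriv.mul_left).add (((hc (-y)).sub (hc y)).mul_left)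

lemma integral_generator (hU : IsDoubleWell U x₀ x₁ x₂) {f : State → ℝ}
    (hf : ∀ y, ContDiff ℝ 1 fun x => f (x, y)) (hc : ∀ y, HasCompactSupport fun x => f (x, y)) (ε : ℝ) (μ : Measure State)
    [IsFiniteMeasure μ] :
    ∫ z, generator U ε f z ∂μ =
      ∫ x, (deriv (fun x => f (x, 1)) x + jumpRate U ε x 1 * (f (x, -1) - f (x, 1))) ∂(slice μ 1) +
      ∫ x, (-deriv (fun x => f (x, -1)) x + jumpRate U ε x (-1) * (f (x, 1) - f (x, -1)))
        ∂(slice μ (-1)) := by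
  rw [integral_eq_slice fun y => hU.integrable_generator hf hc ε _ y]
  simp only [generator, vel_one, vel_neg, one_mul, neg_one_mul, neg_neg]

/-- Up to normalization, the integrand times the weight is the derivative of `exp (-U / ε) * g`. -/
lemma integral_deriv_sub_mul_tilted (hU : IsDoubleWell U x₀ x₁ x₂) (ε : ℝ) {g : ℝ → ℝ}
    (hg : ContDiff ℝ 1 g) (hc : HasCompactSupport g) :
    ∫ x, (deriv g x - deriv U x / ε * g x) ∂((volume : Measure ℝ).tilted fun x => -U x / ε) =
      0 := by
  rw [integral_tilted]
  have hUc := hU.continuous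
  have hU' := hU.continuous_deriv
  have hgc := hg.continuous
  have hg' := hg.continuous_deriv le_rfl
  have h := integral_eq_zero_of_hasDerivAt_of_integrable
    (f := fun x => Real.exp (-U x / ε) * g x)
    (f' := fun x => Real.exp (-U x / ε) * (deriv g x - deriv U x / ε * g x)) (fun x => ?_)
    (Continuous.integrable_of_hasCompactSupport (by fun_prop)
      ((hc.deriv.sub hc.mul_left).mul_left))
    (Continuous.integrable_of_hasCompactSupport (by fun_prop) hc.mul_left)
  · have h0 : ∀ x, (Real.exp (-U x / ε) / ∫ x, Real.exp (-U x / ε)) •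
        (deriv g x - deriv U x / ε * g x) = (Real.exp (-U x / ε) *
          (deriv g x - deriv U x / ε * g x)) / ∫ x, Real.exp (-U x / ε) := fun x => by
      rw [smul_eq_mul, div_mul_eq_mul_div]
    simp only [h0]
    rw [integral_div, h, zero_div]
  · have h1 := (((hU.hasDerivAt x).neg.div_const ε).exp).mul
      ((hg.differentiable (by norm_num)) x).hasDerivAt
    convert! h1 using 1
    simp only [Pi.neg_apply]
    ring

/-- The Gibbs law is invariant. -/
lemma isInvariantLaw_gibbs (hU : IsDoubleWell U x₀ x₁ x₂) (hε : 0 < ε) :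
    IsInvariantLaw U ε (gibbs U ε) := by
  have hprob := hU.isProbabilityMeasure_gibbs hε
  have := hU.isProbabilityMeasure_tilted hε
  refine ⟨hprob, fun f hf hc => ?_⟩
  set γ := (volume : Measure ℝ).tilted fun x => -U x / ε with hγ
  have h1 := hU.integrable_generator hf hc ε γ 1
  have h2 := hU.integrable_generator hf hc ε γ (-1)
  -- Over two equal slices the transport and jump terms combine into the Gibbs formula for `g = f
  -- (·, 1) - f (·, -1)`.
  have h3 := hU.integral_deriv_sub_mul_tilted ε ((hf 1).sub (hf (-1))) ((hc 1).sub (hc (-1)))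
  rw [hU.integral_generator hf hc, slice_gibbs, slice_gibbs, integral_smul_measure,
    integral_smul_measure, ← smul_add, ← hγ]
  simp only [generator, vel_one, vel_neg, one_mul, neg_one_mul, neg_neg] at h1 h2
  rw [← integral_add h1 h2]
  convert! smul_zero _
  rw [← h3]
  refine integral_congr_ae (Eventually.of_forall fun x => ?_)
  simp only
  have hd := fun y => ((hf y).differentiable (by norm_num)) x
  rw [show deriv (fun x => f (x, 1) - f (x, -1)) x = _ from deriv_sub (hd 1) (hd (-1)),
    ← jumpRate_sub_jumpRate]
  ring

/-- A finite measure on the line which satisfies the integration by parts formula of the Gibbs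
weight is a multiple of it. -/
lemma exists_eq_smul_of_integral_eq_zero (hU : IsDoubleWell U x₀ x₁ x₂) (ε : ℝ)
    {ρ : Measure ℝ} [IsFiniteMeasure ρ]
    (h : ∀ g : ℝ → ℝ, ContDiff ℝ 1 g → HasCompactSupport g →
      ∫ x, (deriv g x - deriv U x / ε * g x) ∂ρ = 0) :
    ∃ c : NNReal, ρ = (c : ENNReal) • volume.withDensity
      fun x => ENNReal.ofReal (Real.exp (-U x / ε)) := by
  have hUc := hU.continuous
  have hwc : Continuous fun x => Real.exp (U x / ε) := by fun_prop
  have hwm : Measurable fun x => ENNReal.ofReal (Real.exp (U x / ε)) :=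
    hwc.measurable.ennreal_ofReal
  have hlf : IsLocallyFiniteMeasure (ρ.withDensity fun x => ENNReal.ofReal (Real.exp (U x / ε))) :=
    IsLocallyFiniteMeasure.withDensity_ofReal hwc
  obtain ⟨c, hcν⟩ := exists_eq_smul_volume (ν := ρ.withDensity fun x =>
    ENNReal.ofReal (Real.exp (U x / ε))) (fun k hk hkc => by
      have hE : ContDiff ℝ 1 fun x => Real.exp (U x / ε) :=
        Real.contDiff_exp.comp ((hU.contDiff.of_le (by norm_num)).div_const ε)
      -- On `exp (U / ε) * k` the drift term cancels, and only `exp (U / ε) * k'` remains.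
      have := h (fun x => Real.exp (U x / ε) * k x) (hE.mul hk) hkc.mul_left
      rw [integral_withDensity_eq_integral_toReal_smul hwm
        (Eventually.of_forall fun _ => ENNReal.ofReal_lt_top)]
      rw [← this]
      refine integral_congr_ae (Eventually.of_forall fun x => ?_)
      have h1 : HasDerivAt (fun x => Real.exp (U x / ε) * k x) _ x :=
        (((hU.hasDerivAt x).div_const ε).exp).mul ((hk.differentiable (by norm_num)) x).hasDerivAt
      simp only
      rw [h1.deriv, ENNReal.toReal_ofReal (Real.exp_pos _).le, smul_eq_mul]
      ring)
  refine ⟨c, ?_⟩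
  have h2 := withDensity_inv_same (μ := ρ) hwm (Eventually.of_forall fun x => by simp [Real.exp_pos])
    (Eventually.of_forall fun x => by simp)
  rw [hcν] at h2
  rw [← h2]
  have h3 : (fun x => (ENNReal.ofReal (Real.exp (U x / ε)))⁻¹) =
      fun x => ENNReal.ofReal (Real.exp (-U x / ε)) := by
    ext x
    rw [← ENNReal.ofReal_inv_of_pos (Real.exp_pos _), ← Real.exp_neg, neg_div]
  rw [h3, ← withDensity_smul_measure]
  rfl

lemma tilted_eq_smul (hU : IsDoubleWell U x₀ x₁ x₂) (ε : ℝ) :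
    (volume : Measure ℝ).tilted (fun x => -U x / ε) =
      (ENNReal.ofReal (∫ x, Real.exp (-U x / ε))⁻¹) • volume.withDensity
        fun x => ENNReal.ofReal (Real.exp (-U x / ε)) := by
  have hUc := hU.continuous
  rw [Measure.tilted, ← withDensity_smul _ (by
    exact (Continuous.measurable (by fun_prop)).ennreal_ofReal)]
  congr 1
  ext x
  rw [Pi.smul_apply, smul_eq_mul, div_eq_inv_mul, ENNReal.ofReal_mul
    (inv_nonneg.2 (integral_nonneg fun _ => (Real.exp_pos _).le))]

lemma integral_slice_eq_zero (hU : IsDoubleWell U x₀ x₁ x₂) {μ : Measure State}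
    [IsFiniteMeasure μ]
    (h : ∀ f : State → ℝ, (∀ y, ContDiff ℝ 1 (fun x => f (x, y))) →
      (∀ y, HasCompactSupport (fun x => f (x, y))) → ∫ z, generator U ε f z ∂μ = 0)
    (heq : slice μ 1 = slice μ (-1)) {g : ℝ → ℝ} (hg : ContDiff ℝ 1 g)
    (hc : HasCompactSupport g) :
    ∫ x, (deriv g x - deriv U x / ε * g x) ∂(slice μ 1) = 0 := by
  have hne : (-1 : ℤˣ) ≠ 1 := by decide
  obtain ⟨f, hf1, hf2⟩ : ∃ f : State → ℝ, (∀ x, f (x, 1) = g x) ∧ ∀ x, f (x, -1) = 0 :=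
    ⟨fun z => if z.2 = 1 then g z.1 else 0, fun x => if_pos rfl, fun x => if_neg hne⟩
  have hf : ∀ y : ℤˣ, ContDiff ℝ 1 fun x : ℝ => f (x, y) := by
    intro y
    rcases Int.units_eq_one_or y with rfl | rfl
    · simpa only [hf1] using hg
    · simpa only [hf2] using contDiff_const
  have hc' : ∀ y : ℤˣ, HasCompactSupport fun x : ℝ => f (x, y) := by
    intro y
    rcases Int.units_eq_one_or y with rfl | rfl
    · simpa only [hf1] using hc
    · simp only [hf2]
      exact HasCompactSupport.zero
  have h1 := hU.integrable_generator hf hc' ε (slice μ 1) 1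
  have h2 := hU.integrable_generator hf hc' ε (slice μ 1) (-1)
  have h3 := h _ hf hc'
  rw [hU.integral_generator hf hc', ← heq] at h3
  simp only [generator, vel_one, vel_neg, one_mul, neg_one_mul, neg_neg] at h1 h2
  rw [← integral_add h1 h2] at h3
  rw [← h3]
  refine integral_congr_ae (Eventually.of_forall fun x => ?_)
  simp only [hf1, hf2, deriv_const', ← jumpRate_sub_jumpRate]
  ring

/-- The Gibbs law is the only invariant law. -/
lemma isInvariantLaw_iff (hU : IsDoubleWell U x₀ x₁ x₂) (hε : 0 < ε) (μ : Measure State) :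
    IsInvariantLaw U ε μ ↔ μ = gibbs U ε := by
  refine ⟨fun ⟨hμ, h⟩ => ?_, fun h => h ▸ hU.isInvariantLaw_gibbs hε⟩
  have heq : slice μ 1 = slice μ (-1) := by
    refine eq_of_integral_deriv_eq fun g hg hc => ?_
    -- The jump part vanishes on functions of the position, so the slices agree on derivatives.
    have := h (fun z => g z.1) (fun _ => hg) (fun _ => hc)
    rw [hU.integral_generator (fun _ => hg) (fun _ => hc)] at this
    simp only [sub_self, mul_zero, add_zero, integral_neg] at this
    linarith
  obtain ⟨c, hcρ⟩ := hU.exists_eq_smul_of_integral_eq_zero ε (ρ := slice μ 1)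
    fun g hg hc => hU.integral_slice_eq_zero h heq hg hc
  have hγ := hU.isProbabilityMeasure_tilted hε
  have htilt := hU.tilted_eq_smul ε
  set m := volume.withDensity fun x => ENNReal.ofReal (Real.exp (-U x / ε))
  set b := ENNReal.ofReal (∫ x, Real.exp (-U x / ε))⁻¹
  have hb : b * m Set.univ = 1 := by
    have h1 := hγ.measure_univ
    rwa [htilt, Measure.smul_apply, smul_eq_mul] at h1
  have hc2 : c * m Set.univ = 2⁻¹ := by
    have h1 := hμ.measure_univ
    rw [← map_slice_add_map_slice μ, Measure.add_apply,
      Measure.map_apply (measurableEmbedding_mk _).measurable MeasurableSet.univ,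
      Measure.map_apply (measurableEmbedding_mk _).measurable MeasurableSet.univ, ← heq, hcρ,
      Set.preimage_univ, Set.preimage_univ, ← two_mul, Measure.smul_apply, smul_eq_mul] at h1
    exact ENNReal.eq_inv_of_mul_eq_one_left (by rwa [mul_comm])
  have hcb : (c : ENNReal) = 2⁻¹ * b := by
    rw [← hc2, mul_assoc, mul_comm (m _), hb, mul_one]
  have hfin : ∀ y, slice μ y = slice (gibbs U ε) y := by
    intro y
    rw [slice_gibbs, htilt, smul_smul, ← hcb, ← hcρ]
    rcases Int.units_eq_one_or y with rfl | rfl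
    exacts [rfl, heq.symm]
  rw [← map_slice_add_map_slice μ, hfin, hfin, map_slice_add_map_slice]

end IsDoubleWell

end

/-! ### Excursions as random variables, and their asymptotic size -/

section

/-- Twice the duration of an excursion to the left of `x₀`. -/
def leftTime (U : ℝ → ℝ) (ε x₀ e : ℝ) : ℝ := 2 * holdingTime U ε (x₀, -1) e

/-- Twice the duration of an excursion to the right of `x₀`, truncated at `x₁`. -/
def rightTime (U : ℝ → ℝ) (ε x₀ x₁ e : ℝ) : ℝ := 2 * min (holdingTime U ε (x₀, 1) e) (x₁ - x₀)

/-- The values of the clock for which an excursion to the right of `x₀` does not reach `x₁`. -/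
def failSet (U : ℝ → ℝ) (ε x₀ x₁ : ℝ) : Set ℝ := {e | holdingTime U ε (x₀, 1) e < x₁ - x₀}

/-- The mean duration of a truncated excursion. -/
def meanCycle (U : ℝ → ℝ) (ε x₀ x₁ : ℝ) : ℝ :=
  ∫ e, leftTime U ε x₀ e ∂(expMeasure 1) + ∫ e, rightTime U ε x₀ x₁ e ∂(expMeasure 1)

/-- The probability that an excursion reaches `x₁`. -/
def successProb (U : ℝ → ℝ) (ε x₀ x₁ : ℝ) : ℝ := (expMeasure 1).real (failSet U ε x₀ x₁)ᶜ

namespace IsDoubleWell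

variable {U : ℝ → ℝ} {x₀ x₁ x₂ ε : ℝ}

lemma leftTime_nonneg (hU : IsDoubleWell U x₀ x₁ x₂) (hε : 0 < ε) (e : ℝ) :
    0 ≤ leftTime U ε x₀ e := mul_nonneg (by norm_num) (hU.holdingTime_nonneg hε _ _)

lemma rightTime_nonneg (hU : IsDoubleWell U x₀ x₁ x₂) (hε : 0 < ε) (e : ℝ) :
    0 ≤ rightTime U ε x₀ x₁ e :=
  mul_nonneg (by norm_num) (le_min (hU.holdingTime_nonneg hε _ _) (sub_nonneg.2 hU.lt_left.le))

lemma measurable_leftTime (hU : IsDoubleWell U x₀ x₁ x₂) (hε : 0 < ε) :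
    Measurable (leftTime U ε x₀) :=
  ((hU.measurable_holdingTime hε).comp measurable_prodMk_left).const_mul 2

lemma measurable_rightTime (hU : IsDoubleWell U x₀ x₁ x₂) (hε : 0 < ε) :
    Measurable (rightTime U ε x₀ x₁) :=
  (((hU.measurable_holdingTime hε).comp measurable_prodMk_left).min measurable_const).const_mul 2

lemma measurableSet_failSet (hU : IsDoubleWell U x₀ x₁ x₂) (hε : 0 < ε) :
    MeasurableSet (failSet U ε x₀ x₁) :=
  measurableSet_lt ((hU.measurable_holdingTime hε).comp measurable_prodMk_left) measurable_const

lemma rightTime_le (U : ℝ → ℝ) (ε x₀ x₁ e : ℝ) : rightTime U ε x₀ x₁ e ≤ 2 * (x₁ - x₀) :=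
  mul_le_mul_of_nonneg_left (min_le_right _ _) (by norm_num)

/-! ### Bounds on the excursions -/

/-- The flight stops when `U` has risen by `ε * e`, and `U` grows at least linearly. That `K` does
not depend on `ε` is what makes the variances uniformly bounded. -/
lemma exists_leftTime_le (hU : IsDoubleWell U x₀ x₁ x₂) :
    ∃ K : ℝ, 0 ≤ K ∧ ∀ ε, 0 < ε → ∀ e, 0 < e → leftTime U ε x₀ e ≤ K * (1 + ε * e) := by
  obtain ⟨b, hb, a, ha⟩ := hU.exists_mul_abs_sub_le
  refine ⟨2 * (|x₀| + |a + U x₀| / b + 1 / b), by positivity, fun ε hε e he => ?_⟩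
  have hpos := hU.holdingTime_pos hε (x₀, -1) he
  have h1 := hU.cumRate_holdingTime hε (x₀, -1) he
  rw [hU.cumRate_left ε hpos.le, div_eq_iff hε.ne'] at h1
  set t := holdingTime U ε (x₀, -1) e with ht
  have h2 := ha (x₀ - t)
  have h3 : |x₀ - t| ≤ |a + U x₀| / b + 1 / b * (ε * e) := by
    rw [← mul_le_mul_iff_right₀ hb]
    have : b * (|a + U x₀| / b + 1 / b * (ε * e)) = |a + U x₀| + ε * e := by field_simp
    rw [this]
    linarith [le_abs_self (a + U x₀), mul_comm ε e]
  have h4 : t ≤ |x₀| + |x₀ - t| := by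
    have := abs_sub_abs_le_abs_sub t x₀
    rw [abs_sub_comm t x₀, abs_of_pos hpos] at this
    linarith
  have h5 : 0 ≤ (|x₀| + |a + U x₀| / b) * (ε * e) := by positivity
  have h6 : 0 ≤ 1 / b := by positivity
  rw [leftTime, ← ht]
  nlinarith

lemma _root_.VelocityJump.memLp_affine (a b : ℝ) :
    MemLp (fun e : ℝ => a * (1 + b * e)) 2 (expMeasure 1) := by
  have h1 : MemLp (fun _ : ℝ => (1 : ℝ)) 2 (expMeasure 1) := memLp_const 1
  have h2 : MemLp (fun e : ℝ => b * e) 2 (expMeasure 1) := memLp_id_expMeasure.const_mul b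
  have h3 : MemLp (fun e : ℝ => 1 + b * e) 2 (expMeasure 1) := h1.add h2
  exact h3.const_mul a

lemma memLp_leftTime (hU : IsDoubleWell U x₀ x₁ x₂) (hε : 0 < ε) :
    MemLp (leftTime U ε x₀) 2 (expMeasure 1) := by
  obtain ⟨K, hK, hK'⟩ := hU.exists_leftTime_le
  refine (memLp_affine K ε).of_le (hU.measurable_leftTime hε).aestronglyMeasurable ?_
  filter_upwards [ae_pos_expMeasure] with e he
  rw [Real.norm_of_nonneg (hU.leftTime_nonneg hε e)]
  exact (hK' ε hε e he).trans (le_abs_self _)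

lemma memLp_rightTime (hU : IsDoubleWell U x₀ x₁ x₂) (hε : 0 < ε) :
    MemLp (rightTime U ε x₀ x₁) 2 (expMeasure 1) :=
  MemLp.of_bound (hU.measurable_rightTime hε).aestronglyMeasurable (2 * (x₁ - x₀))
    (Eventually.of_forall fun e => by
      rw [Real.norm_of_nonneg (hU.rightTime_nonneg hε e)]
      exact rightTime_le U ε x₀ x₁ e)

lemma exists_variance_le (hU : IsDoubleWell U x₀ x₁ x₂) :
    ∃ V : ℝ, ∀ ε, 0 < ε → ε ≤ 1 → Var[leftTime U ε x₀; expMeasure 1] +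
      Var[rightTime U ε x₀ x₁; expMeasure 1] ≤ V := by
  obtain ⟨K, hK, hK'⟩ := hU.exists_leftTime_le
  refine ⟨∫ e, (K * (1 + e)) ^ 2 ∂(expMeasure 1) + (2 * (x₁ - x₀)) ^ 2, fun ε hε hε1 => ?_⟩
  have hg : MemLp (fun e : ℝ => K * (1 + e)) 2 (expMeasure 1) := by
    simpa only [one_mul] using memLp_affine K 1
  gcongr
  · refine (variance_le_expectation_sq
      (hU.measurable_leftTime hε).aestronglyMeasurable).trans ?_
    refine integral_mono_ae (hU.memLp_leftTime hε).integrable_sq hg.integrable_sq ?_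
    filter_upwards [ae_pos_expMeasure] with e he
    refine pow_le_pow_left₀ (hU.leftTime_nonneg hε e) ((hK' ε hε e he).trans ?_) 2
    gcongr
    nlinarith
  · refine (variance_le_expectation_sq
      (hU.measurable_rightTime hε).aestronglyMeasurable).trans ?_
    have h := integral_mono (hU.memLp_rightTime (x₁ := x₁) hε).integrable_sq
      (integrable_const (μ := expMeasure 1) ((2 * (x₁ - x₀)) ^ 2)) fun e =>
        pow_le_pow_left₀ (hU.rightTime_nonneg hε e) (rightTime_le U ε x₀ x₁ e) 2
    simpa using h

/-- Near `x₀` the slope of `U` is bounded, so climbing `ε * e` takes time at least of order `ε`.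
This crude order is enough against an exponentially small success probability. -/
lemma exists_le_meanCycle (hU : IsDoubleWell U x₀ x₁ x₂) :
    ∃ κ : ℝ, 0 < κ ∧ ∀ ε, 0 < ε → ε ≤ 1 → κ * ε ≤ meanCycle U ε x₀ x₁ := by
  obtain ⟨L, hL⟩ := (isCompact_Icc (a := x₀ - 1) (b := x₀)).exists_bound_of_continuousOn
    hU.continuous_deriv.continuousOn
  have hL0 : 0 ≤ L := (norm_nonneg _).trans (hL x₀ (by simp))
  have hLU : ∀ t ∈ Set.Icc (0 : ℝ) 1, U (x₀ - t) - U x₀ ≤ (L + 1) * t := by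
    intro t ht
    have := (convex_Icc (x₀ - 1) x₀).norm_image_sub_le_of_norm_deriv_le
      (fun x _ => hU.differentiable x) hL (x := x₀) (y := x₀ - t) (by simp)
      ⟨by linarith [ht.2], by linarith [ht.1]⟩
    rw [sub_sub_cancel_left, norm_neg, Real.norm_of_nonneg ht.1] at this
    linarith [le_abs_self (U (x₀ - t) - U x₀), ht.1, Real.norm_eq_abs (U (x₀ - t) - U x₀)]
  -- `Real.exp (-1)` is the probability that the clock exceeds `1`; `L + 1` keeps the slope bound
  -- positive.
  refine ⟨Real.exp (-1) * (1 / (L + 1)), by positivity, fun ε hε hε1 => ?_⟩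
  have hlow : ∀ e, 1 < e → 1 / (L + 1) * ε ≤ leftTime U ε x₀ e := by
    intro e he
    have hpos := hU.holdingTime_pos hε (x₀, -1) (zero_lt_one.trans he)
    have h1 := hU.cumRate_holdingTime hε (x₀, -1) (zero_lt_one.trans he)
    rw [hU.cumRate_left ε hpos.le, div_eq_iff hε.ne'] at h1
    rw [leftTime]
    set t := holdingTime U ε (x₀, -1) e
    rw [div_mul_eq_mul_div, one_mul, div_le_iff₀ (by positivity)]
    rcases le_total t 1 with h | h
    · have := hLU t ⟨hpos.le, h⟩
      nlinarith
    · nlinarith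
  have hA := (hU.memLp_leftTime hε).integrable (by norm_num)
  have h1 : Real.exp (-1) * (1 / (L + 1)) * ε ≤ ∫ e, leftTime U ε x₀ e ∂(expMeasure 1) := by
    have h2 : ∫ e, (Set.Ioi (1 : ℝ)).indicator (fun _ => 1 / (L + 1) * ε) e ∂(expMeasure 1) =
        Real.exp (-1) * (1 / (L + 1)) * ε := by
      rw [integral_indicator_const _ measurableSet_Ioi, expMeasure_real_Ioi zero_le_one,
        smul_eq_mul]
      ring
    rw [← h2]
    refine integral_mono ((integrable_const _).indicator measurableSet_Ioi) hA fun e => ?_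
    by_cases he : 1 < e
    · rw [Set.indicator_of_mem (Set.mem_Ioi.2 he)]
      exact hlow e he
    · rw [Set.indicator_of_notMem (by simpa using he)]
      exact hU.leftTime_nonneg hε e
  have h2 : 0 ≤ ∫ e, rightTime U ε x₀ x₁ e ∂(expMeasure 1) :=
    integral_nonneg (hU.rightTime_nonneg hε)
  rw [meanCycle]
  linarith

lemma cumRate_barrier (hU : IsDoubleWell U x₀ x₁ x₂) (ε : ℝ) :
    cumRate U ε (x₀, 1) (x₁ - x₀) = (U x₁ - U x₀) / ε := by
  rw [hU.cumRate_right ε (sub_nonneg.2 hU.lt_left.le) le_rfl, add_sub_cancel]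

lemma successProb_pos (hU : IsDoubleWell U x₀ x₁ x₂) (hε : 0 < ε) :
    0 < successProb U ε x₀ x₁ := by
  have h0 : 0 ≤ (U x₁ - U x₀) / ε := (div_pos hU.barrier_pos hε).le
  have h := expMeasure_real_Ioi h0
  refine (Real.exp_pos (-((U x₁ - U x₀) / ε))).trans_le ?_
  rw [← h]
  refine measureReal_mono fun e he => ?_
  simp only [failSet, Set.mem_compl_iff, Set.mem_ofPred_eq, not_lt]
  by_contra! hcon
  have h1 := hU.le_cumRate_holdingTime hε (x₀, 1) e
  have h2 := hU.monotone_cumRate hε (x₀, 1) hcon.le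
  rw [hU.cumRate_barrier] at h2
  exact absurd (h1.trans h2) (not_le.2 he)

/-- Success forces the clock to be at least the barrier over `ε`. Halving the barrier makes this
inequality strict, as the tail formula for open half-lines requires. -/
lemma successProb_le (hU : IsDoubleWell U x₀ x₁ x₂) (hε : 0 < ε) :
    successProb U ε x₀ x₁ ≤ Real.exp (-((U x₁ - U x₀) / 2 / ε)) := by
  have hb := hU.barrier_pos
  rw [← expMeasure_real_Ioi (by positivity)]
  refine measureReal_mono fun e he => ?_
  simp only [failSet, Set.mem_compl_iff, Set.mem_ofPred_eq, not_lt] at he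
  have h1 : (U x₁ - U x₀) / ε ≤ e := by
    rw [← hU.cumRate_barrier]
    have h2 : Tendsto (cumRate U ε (x₀, 1)) (𝓝[<] (x₁ - x₀))
        (𝓝 (cumRate U ε (x₀, 1) (x₁ - x₀))) :=
      (hU.continuous_cumRate ε _).continuousAt.mono_left nhdsWithin_le_nhds
    refine le_of_tendsto h2 ?_
    filter_upwards [Ioo_mem_nhdsLT (sub_pos.2 hU.lt_left)] with u hu
    exact (cumRate_lt hu.1 (hu.2.trans_le he)).le
  refine lt_of_lt_of_le ?_ h1
  gcongr
  linarith

lemma measure_failSet (hU : IsDoubleWell U x₀ x₁ x₂) (hε : 0 < ε) :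
    (expMeasure 1).real (failSet U ε x₀ x₁) = 1 - successProb U ε x₀ x₁ := by
  rw [successProb, probReal_compl_eq_one_sub (hU.measurableSet_failSet hε)]
  ring

/-! ### The hitting time -/

lemma _root_.VelocityJump.cycleTime_eq (U : ℝ → ℝ) (ε x₀ x₁ e₀ e₁ : ℝ) :
    cycleTime U ε x₀ x₁ e₀ e₁ = leftTime U ε x₀ e₀ + rightTime U ε x₀ x₁ e₁ := rfl

/-- The total duration of the excursions up to and including the first successful one. -/
def _root_.VelocityJump.totalTime (U : ℝ → ℝ) (ε x₀ x₁ : ℝ) {Ω : Type*} (E : ℕ → Ω → ℝ) (ω : Ω) : ENNReal :=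
  ∑' k, ({ω | ∀ j < k, E (2 * j + 1) ω ∈ failSet U ε x₀ x₁}.indicator 1 ω *
      ENNReal.ofReal (leftTime U ε x₀ (E (2 * k) ω)) +
    {ω | ∀ j < k, E (2 * j + 1) ω ∈ failSet U ε x₀ x₁}.indicator 1 ω *
      ENNReal.ofReal (rightTime U ε x₀ x₁ (E (2 * k + 1) ω)))

lemma totalTime_eq (hU : IsDoubleWell U x₀ x₁ x₂) (hε : 0 < ε) {Ω : Type*} {E : ℕ → Ω → ℝ} {ω : Ω} {n : ℕ}
    (h : ∀ j < n, E (2 * j + 1) ω ∈ failSet U ε x₀ x₁)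
    (hn : E (2 * n + 1) ω ∉ failSet U ε x₀ x₁) :
    totalTime U ε x₀ x₁ E ω =
      ENNReal.ofReal (cycleSum U ε x₀ x₁ (fun k => E k ω) (n + 1)) := by
  have hA0 := hU.leftTime_nonneg hε
  have hB0 := hU.rightTime_nonneg hε
  rw [totalTime, tsum_eq_sum (s := Finset.range (n + 1)), cycleSum,
    ENNReal.ofReal_sum_of_nonneg fun j _ => hU.cycleTime_nonneg hε _ _]
  · refine Finset.sum_congr rfl fun k hk => ?_
    rw [Set.indicator_of_mem (by
      intro j hj
      exact h j (by simp only [Finset.mem_range] at hk; omega)), Pi.one_apply, one_mul, one_mul,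
      cycleTime_eq, ENNReal.ofReal_add (hA0 _) (hB0 _)]
  · intro k hk
    rw [Set.indicator_of_notMem, zero_mul, zero_mul, add_zero]
    intro hmem
    exact hn (hmem n (by simp only [Finset.mem_range] at hk; omega))

variable {Ω : Type*} [MeasurableSpace Ω] {P : Measure Ω} {E : ℕ → Ω → ℝ}

/-- The odd clocks are independent and each fails with the same probability less than `1`, so
perpetual failure has probability `0`. -/
lemma ae_exists_success [IsProbabilityMeasure P] (hU : IsDoubleWell U x₀ x₁ x₂) (hε : 0 < ε)
    (hE_law : ∀ k, HasLaw (E k) (expMeasure 1) P) (hE_indep : iIndepFun E P) :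
    ∀ᵐ ω ∂P, ∃ n, (∀ j < n, E (2 * j + 1) ω ∈ failSet U ε x₀ x₁) ∧
      E (2 * n + 1) ω ∉ failSet U ε x₀ x₁ := by
  have hF := hU.measurableSet_failSet hε
  have hlt : expMeasure 1 (failSet U ε x₀ x₁) < 1 := by
    have h1 := hU.measure_failSet hε
    have h2 := hU.successProb_pos hε
    rw [← ENNReal.toReal_lt_toReal (measure_ne_top _ _) ENNReal.one_ne_top, ENNReal.toReal_one]
    change (expMeasure 1).real (failSet U ε x₀ x₁) < 1
    linarith
  have h0 : P {ω | ∀ j, E (2 * j + 1) ω ∈ failSet U ε x₀ x₁} = 0 := by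
    refine le_antisymm (ge_of_tendsto' (ENNReal.tendsto_pow_atTop_nhds_zero_of_lt_one hlt)
      fun k => ?_) zero_le
    rw [← measure_forall_lt hE_law hE_indep hF k]
    exact measure_mono fun ω hω j _ => hω j
  have h1 : ∀ᵐ ω ∂P, ¬ ∀ j, E (2 * j + 1) ω ∈ failSet U ε x₀ x₁ := by
    rw [ae_iff]; simpa using h0
  filter_upwards [h1] with ω hω
  push Not at hω
  classical
  exact ⟨Nat.find hω, fun j hj => not_not.1 (Nat.find_min hω hj), Nat.find_spec hω⟩

lemma _root_.VelocityJump.ae_forall_pos (hE_law : ∀ k, HasLaw (E k) (expMeasure 1) P) :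
    ∀ᵐ ω ∂P, ∀ k, 0 < E k ω :=
  ae_all_iff.2 fun k => ((hE_law k).ae_iff (p := fun x => 0 < x)
    measurableSet_Ioi.mem).2 ae_pos_expMeasure

lemma _root_.VelocityJump.nullMeasurableSet_forall_lt
    (hE_law : ∀ k, HasLaw (E k) (expMeasure 1) P) {F : Set ℝ} (hF : MeasurableSet F) (k : ℕ) :
    NullMeasurableSet {ω | ∀ j < k, E (2 * j + 1) ω ∈ F} P := by
  simp only [Set.ofPred_forall]
  exact NullMeasurableSet.iInter fun j => NullMeasurableSet.iInter fun _ =>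
    (hE_law (2 * j + 1)).aemeasurable.nullMeasurableSet_preimage hF

lemma aemeasurable_totalTime_term (hU : IsDoubleWell U x₀ x₁ x₂) (hε : 0 < ε)
    (hE_law : ∀ k, HasLaw (E k) (expMeasure 1) P) (k m : ℕ) {f : ℝ → ℝ} (hf : Measurable f) :
    AEMeasurable (fun ω => {ω | ∀ j < k, E (2 * j + 1) ω ∈ failSet U ε x₀ x₁}.indicator
      (1 : Ω → ENNReal) ω * ENNReal.ofReal (f (E m ω))) P := by
  have hi : AEMeasurable ({ω | ∀ j < k, E (2 * j + 1) ω ∈ failSet U ε x₀ x₁}.indicator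
      (1 : Ω → ENNReal)) P :=
    aemeasurable_one.indicator₀ (nullMeasurableSet_forall_lt hE_law (hU.measurableSet_failSet hε) k)
  exact hi.mul (hf.comp_aemeasurable (hE_law m).aemeasurable).ennreal_ofReal

lemma aemeasurable_totalTime_summand (hU : IsDoubleWell U x₀ x₁ x₂) (hε : 0 < ε)
    (hE_law : ∀ k, HasLaw (E k) (expMeasure 1) P) (k : ℕ) :
    AEMeasurable (fun ω => {ω | ∀ j < k, E (2 * j + 1) ω ∈ failSet U ε x₀ x₁}.indicator 1 ω *
      ENNReal.ofReal (leftTime U ε x₀ (E (2 * k) ω)) +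
    {ω | ∀ j < k, E (2 * j + 1) ω ∈ failSet U ε x₀ x₁}.indicator 1 ω *
      ENNReal.ofReal (rightTime U ε x₀ x₁ (E (2 * k + 1) ω))) P :=
  (hU.aemeasurable_totalTime_term hε hE_law _ _ (hU.measurable_leftTime hε)).add
    (hU.aemeasurable_totalTime_term hε hE_law _ _ (hU.measurable_rightTime hε))

/-- Wald's identity: excursion `k` takes place with probability `(1 - p) ^ k`, independently of its
duration, and the geometric series sums to `1 / p`. Working in `ENNReal` allows the exchange of sum
and integral without prior integrability. -/
lemma lintegral_totalTime [IsProbabilityMeasure P] (hU : IsDoubleWell U x₀ x₁ x₂) (hε : 0 < ε)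
    (hE_law : ∀ k, HasLaw (E k) (expMeasure 1) P) (hE_indep : iIndepFun E P) :
    ∫⁻ ω, totalTime U ε x₀ x₁ E ω ∂P =
      ENNReal.ofReal (meanCycle U ε x₀ x₁ / successProb U ε x₀ x₁) := by
  have hF := hU.measurableSet_failSet hε
  have hA := hU.measurable_leftTime hε
  have hB := hU.measurable_rightTime (x₁ := x₁) hε
  have hA0 := hU.leftTime_nonneg hε
  have hB0 := hU.rightTime_nonneg hε
  have hq : expMeasure 1 (failSet U ε x₀ x₁) = ENNReal.ofReal (1 - successProb U ε x₀ x₁) := by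
    rw [← hU.measure_failSet hε, ofReal_measureReal]
  have hp := hU.successProb_pos hε
  simp only [totalTime]
  rw [lintegral_tsum fun k => hU.aemeasurable_totalTime_summand hε hE_law k]
  have hterm : ∀ k : ℕ, ∫⁻ ω, ({ω | ∀ j < k, E (2 * j + 1) ω ∈ failSet U ε x₀ x₁}.indicator 1 ω *
      ENNReal.ofReal (leftTime U ε x₀ (E (2 * k) ω)) +
    {ω | ∀ j < k, E (2 * j + 1) ω ∈ failSet U ε x₀ x₁}.indicator 1 ω *
      ENNReal.ofReal (rightTime U ε x₀ x₁ (E (2 * k + 1) ω))) ∂P =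
      ENNReal.ofReal (1 - successProb U ε x₀ x₁) ^ k *
        ENNReal.ofReal (meanCycle U ε x₀ x₁) := by
    intro k
    rw [lintegral_add_left' (hU.aemeasurable_totalTime_term hε hE_law _ _ hA),
      lintegral_indicator_mul_comp hE_law hE_indep hF hA.ennreal_ofReal le_rfl,
      lintegral_indicator_mul_comp hE_law hE_indep hF hB.ennreal_ofReal (by omega), ← mul_add,
      ← ofReal_integral_eq_lintegral_ofReal ((hU.memLp_leftTime hε).integrable (by norm_num))
        (Eventually.of_forall hA0),
      ← ofReal_integral_eq_lintegral_ofReal ((hU.memLp_rightTime hε).integrable (by norm_num))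
        (Eventually.of_forall hB0),
      ← ENNReal.ofReal_add (integral_nonneg hA0) (integral_nonneg hB0), hq]
    rfl
  simp only [hterm]
  have h1 : 0 ≤ 1 - successProb U ε x₀ x₁ := by
    rw [← hU.measure_failSet hε]; exact measureReal_nonneg
  rw [ENNReal.tsum_mul_right, ENNReal.tsum_geometric, ← ENNReal.ofReal_one,
    ← ENNReal.ofReal_sub _ h1, sub_sub_cancel, ← ENNReal.ofReal_inv_of_pos hp,
    ← ENNReal.ofReal_mul (inv_nonneg.2 hp.le), div_eq_inv_mul]

lemma hittingTime_ae_eq [IsProbabilityMeasure P] (hU : IsDoubleWell U x₀ x₁ x₂) (hε : 0 < ε)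
    (hE_law : ∀ k, HasLaw (E k) (expMeasure 1) P) (hE_indep : iIndepFun E P) :
    (fun ω => hittingTime U ε (x₀, -1) x₁ fun k => E k ω) =ᵐ[P]
      fun ω => (totalTime U ε x₀ x₁ E ω).toReal - (x₁ - x₀) := by
  filter_upwards [ae_forall_pos hE_law, hU.ae_exists_success hε hE_law hE_indep]
    with ω hpos ⟨n, hn, hn'⟩
  have hs : 0 ≤ cycleSum U ε x₀ x₁ (fun k => E k ω) (n + 1) :=
    Finset.sum_nonneg fun j _ => hU.cycleTime_nonneg hε _ _
  rw [hU.totalTime_eq hε hn hn', ENNReal.toReal_ofReal hs,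
    hU.hittingTime_eq hε hpos hn (by simpa [failSet] using hn')]

lemma aemeasurable_totalTime (hU : IsDoubleWell U x₀ x₁ x₂) (hε : 0 < ε)
    (hE_law : ∀ k, HasLaw (E k) (expMeasure 1) P) :
    AEMeasurable (totalTime U ε x₀ x₁ E) P :=
  AEMeasurable.tsum fun k => hU.aemeasurable_totalTime_summand hε hE_law k

lemma integrable_totalTime [IsProbabilityMeasure P] (hU : IsDoubleWell U x₀ x₁ x₂) (hε : 0 < ε)
    (hE_law : ∀ k, HasLaw (E k) (expMeasure 1) P) (hE_indep : iIndepFun E P) :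
    Integrable (fun ω => (totalTime U ε x₀ x₁ E ω).toReal) P :=
  integrable_toReal_of_lintegral_ne_top (hU.aemeasurable_totalTime hε hE_law)
    (by rw [hU.lintegral_totalTime hε hE_law hE_indep]; exact ENNReal.ofReal_ne_top)

/-- The hitting time of `x₁` is integrable. -/
lemma integrable_hittingTime [IsProbabilityMeasure P] (hU : IsDoubleWell U x₀ x₁ x₂) (hε : 0 < ε)
    (hE_law : ∀ k, HasLaw (E k) (expMeasure 1) P) (hE_indep : iIndepFun E P) :
    Integrable (fun ω => hittingTime U ε (x₀, -1) x₁ fun k => E k ω) P :=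
  ((hU.integrable_totalTime hε hE_law hE_indep).sub (integrable_const _)).congr
    (hU.hittingTime_ae_eq hε hE_law hE_indep).symm

lemma meanCycle_nonneg (hU : IsDoubleWell U x₀ x₁ x₂) (hε : 0 < ε) :
    0 ≤ meanCycle U ε x₀ x₁ :=
  add_nonneg (integral_nonneg (hU.leftTime_nonneg hε)) (integral_nonneg (hU.rightTime_nonneg hε))

lemma integral_hittingTime_le [IsProbabilityMeasure P] (hU : IsDoubleWell U x₀ x₁ x₂) (hε : 0 < ε)
    (hE_law : ∀ k, HasLaw (E k) (expMeasure 1) P) (hE_indep : iIndepFun E P) :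
    ∫ ω, hittingTime U ε (x₀, -1) x₁ (fun k => E k ω) ∂P ≤
      meanCycle U ε x₀ x₁ / successProb U ε x₀ x₁ := by
  have hlt : ∀ᵐ ω ∂P, totalTime U ε x₀ x₁ E ω < ⊤ :=
    ae_lt_top' (hU.aemeasurable_totalTime hε hE_law)
      (by rw [hU.lintegral_totalTime hε hE_law hE_indep]; exact ENNReal.ofReal_ne_top)
  rw [integral_congr_ae (hU.hittingTime_ae_eq hε hE_law hE_indep),
    integral_sub (hU.integrable_totalTime hε hE_law hE_indep) (integrable_const _),
    integral_toReal (hU.aemeasurable_totalTime hε hE_law) hlt,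
    hU.lintegral_totalTime hε hE_law hE_indep, ENNReal.toReal_ofReal
      (div_nonneg (hU.meanCycle_nonneg hε) (hU.successProb_pos hε).le)]
  have := hU.lt_left
  simp
  linarith

lemma integral_hittingTime_nonneg (U : ℝ → ℝ) (ε x₀ x₁ : ℝ) :
    0 ≤ ∫ ω, hittingTime U ε (x₀, -1) x₁ (fun k => E k ω) ∂P :=
  integral_nonneg fun _ => Real.sInf_nonneg fun _ h => h.1.le

lemma aemeasurable_path (hU : IsDoubleWell U x₀ x₁ x₂) (hε : 0 < ε)
    (hE_law : ∀ k, HasLaw (E k) (expMeasure 1) P) (z : State) (s : ℝ) :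
    AEMeasurable (fun ω => path U ε z (fun k => E k ω) s) P :=
  (hU.measurable_path hε z s).comp_aemeasurable
    (aemeasurable_pi_lambda _ fun k => (hE_law k).aemeasurable)

/-- A lower bound on the probability that the process is still on the left of `x₁` at time `s`. -/
lemma le_measureReal_path_fst_lt [IsProbabilityMeasure P] (hU : IsDoubleWell U x₀ x₁ x₂)
    (hε : 0 < ε) (hE_law : ∀ k, HasLaw (E k) (expMeasure 1) P) (hE_indep : iIndepFun E P)
    {s : ℝ} (hs : 0 ≤ s) {n : ℕ} (hn : s < n * meanCycle U ε x₀ x₁) :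
    (1 - successProb U ε x₀ x₁) ^ n -
      n * (Var[leftTime U ε x₀; expMeasure 1] + Var[rightTime U ε x₀ x₁; expMeasure 1]) /
        (n * meanCycle U ε x₀ x₁ - s) ^ 2 ≤
      P.real {ω | (path U ε (x₀, -1) (fun k => E k ω) s).1 < x₁} := by
  have h1 := measureReal_sum_le hE_law hE_indep (hU.measurable_leftTime hε)
    (hU.measurable_rightTime (x₁ := x₁) hε) (hU.memLp_leftTime hε) (hU.memLp_rightTime hε) n hn
  have h2 : P.real {ω | ∀ j < n, E (2 * j + 1) ω ∈ failSet U ε x₀ x₁} =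
      (1 - successProb U ε x₀ x₁) ^ n := by
    rw [measureReal_def, measure_forall_lt hE_law hE_indep (hU.measurableSet_failSet hε),
      ENNReal.toReal_pow, ← hU.measure_failSet hε]
    rfl
  -- When the first `n` excursions fail, the path can have reached `x₁` by time `s` only if their
  -- total duration is at most `s`.
  have h3 : ({ω | ∀ j < n, E (2 * j + 1) ω ∈ failSet U ε x₀ x₁} : Set Ω) ≤ᵐ[P]
      ({ω | (path U ε (x₀, -1) (fun k => E k ω) s).1 < x₁} ∪
      {ω | ∑ j ∈ Finset.range n, (leftTime U ε x₀ (E (2 * j) ω) +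
        rightTime U ε x₀ x₁ (E (2 * j + 1) ω)) ≤ s} : Set Ω) := by
    filter_upwards [ae_forall_pos hE_law, hU.ae_exists_success hε hE_law hE_indep]
      with ω hpos ⟨m, hm, hm'⟩ hω
    by_cases hsum : ∑ j ∈ Finset.range n, (leftTime U ε x₀ (E (2 * j) ω) +
        rightTime U ε x₀ x₁ (E (2 * j + 1) ω)) ≤ s
    · exact Or.inr hsum
    · refine Or.inl (hU.path_fst_lt hε hpos hm (by simpa [failSet] using hm') hs ?_)
      have hnm : n ≤ m := by
        by_contra! hcon
        exact hm' (hω m hcon)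
      have h4 : cycleSum U ε x₀ x₁ (fun k => E k ω) n ≤ cycleSum U ε x₀ x₁ (fun k => E k ω) m :=
        Finset.sum_le_sum_of_subset_of_nonneg (Finset.range_mono hnm)
          fun _ _ _ => hU.cycleTime_nonneg hε _ _
      have h5 : cycleSum U ε x₀ x₁ (fun k => E k ω) (m + 1) =
          cycleSum U ε x₀ x₁ (fun k => E k ω) m +
            cycleTime U ε x₀ x₁ (E (2 * m) ω) (E (2 * m + 1) ω) := Finset.sum_range_succ _ _
      have h6 : x₁ - x₀ ≤ holdingTime U ε (x₀, 1) (E (2 * m + 1) ω) := by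
        simpa [failSet] using hm'
      have h7 := hU.holdingTime_nonneg hε (x₀, -1) (E (2 * m) ω)
      rw [cycleTime, min_eq_right h6] at h5
      have h8 : s < cycleSum U ε x₀ x₁ (fun k => E k ω) n := not_le.1 hsum
      linarith [hU.lt_left]
  have h4 := (ENNReal.toReal_mono (measure_ne_top _ _) (measure_mono_ae h3)).trans
    (measureReal_union_le _ _)
  change P.real _ ≤ _ at h4
  rw [h2] at h4
  change _ ≤ _ / (n * meanCycle U ε x₀ x₁ - s) ^ 2 at h1
  linarith

end IsDoubleWell

end

section

/-! ### Total variation -/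

lemma bddAbove_tvDist {W : Type*} [MeasurableSpace W] (ν ν' : Measure W) [IsProbabilityMeasure ν]
    [IsProbabilityMeasure ν'] :
    BddAbove (Set.range fun A : {A : Set W // MeasurableSet A} => |ν.real A - ν'.real A|) := by
  refine ⟨1, ?_⟩
  rintro _ ⟨A, rfl⟩
  have h1 := measureReal_nonneg (μ := ν) (s := (A : Set W))
  have h2 := measureReal_nonneg (μ := ν') (s := (A : Set W))
  have h3 := measureReal_le_one (μ := ν) (s := (A : Set W))
  have h4 := measureReal_le_one (μ := ν') (s := (A : Set W))
  exact abs_le.2 ⟨by linarith, by linarith⟩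

lemma tvDist_le_one {W : Type*} [MeasurableSpace W] (ν ν' : Measure W) [IsProbabilityMeasure ν]
    [IsProbabilityMeasure ν'] : tvDist ν ν' ≤ 1 := by
  have : Nonempty {A : Set W // MeasurableSet A} := ⟨⟨∅, MeasurableSet.empty⟩⟩
  refine ciSup_le fun A => ?_
  have h1 := measureReal_nonneg (μ := ν) (s := (A : Set W))
  have h2 := measureReal_nonneg (μ := ν') (s := (A : Set W))
  have h3 := measureReal_le_one (μ := ν) (s := (A : Set W))
  have h4 := measureReal_le_one (μ := ν') (s := (A : Set W))
  exact abs_le.2 ⟨by linarith, by linarith⟩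

lemma sub_le_tvDist {W : Type*} [MeasurableSpace W] (ν ν' : Measure W) [IsProbabilityMeasure ν]
    [IsProbabilityMeasure ν'] {A : Set W} (hA : MeasurableSet A) :
    ν.real A - ν'.real A ≤ tvDist ν ν' :=
  (le_abs_self _).trans (le_ciSup (bddAbove_tvDist ν ν') ⟨A, hA⟩)

/-! ### Asymptotics at low temperature -/

lemma tendsto_exp_neg_div {h : ℝ} (hh : 0 < h) :
    Tendsto (fun ε => Real.exp (-(h / ε))) (𝓝[>] (0 : ℝ)) (𝓝 0) := by
  have h1 : Tendsto (fun ε : ℝ => h / ε) (𝓝[>] (0 : ℝ)) atTop :=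
    tendsto_inv_nhdsGT_zero.const_mul_atTop hh
  exact Real.tendsto_exp_neg_atTop_nhds_zero.comp h1

lemma tendsto_exp_neg_div_div_sq {h : ℝ} (hh : 0 < h) :
    Tendsto (fun ε => Real.exp (-(h / ε)) / ε ^ 2) (𝓝[>] (0 : ℝ)) (𝓝 0) := by
  have h1 : Tendsto (fun ε : ℝ => h / ε) (𝓝[>] (0 : ℝ)) atTop :=
    tendsto_inv_nhdsGT_zero.const_mul_atTop hh
  have h2 := ((Real.tendsto_pow_mul_exp_neg_atTop_nhds_zero 2).comp h1).const_mul (h ^ 2)⁻¹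
  rw [mul_zero] at h2
  refine h2.congr fun ε => ?_
  simp only [Function.comp_apply]
  field_simp

namespace IsDoubleWell

variable {U : ℝ → ℝ} {x₀ x₁ x₂ ε : ℝ}

lemma gibbs_real_left (U : ℝ → ℝ) (ε x₁ : ℝ) :
    (gibbs U ε).real {z | z.1 < x₁} =
      ((volume : Measure ℝ).tilted fun x => -U x / ε).real (Set.Iio x₁) := by
  have : IsProbabilityMeasure (uniformOn (Set.univ : Set ℤˣ)) :=
    isProbabilityMeasure_uniformOn Set.finite_univ Set.univ_nonempty
  have h : {z : State | z.1 < x₁} = Set.Iio x₁ ×ˢ Set.univ := by ext; simp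
  rw [measureReal_def, h, gibbs, Measure.prod_prod, measure_univ, mul_one, measureReal_def]

/-- The Gibbs law concentrates in the deepest well. -/
lemma tendsto_gibbs_left (hU : IsDoubleWell U x₀ x₁ x₂) (hmin : U x₂ < U x₀) :
    Tendsto (fun ε => (gibbs U ε).real {z | z.1 < x₁}) (𝓝[>] (0 : ℝ)) (𝓝 0) := by
  -- Near `x₂` the potential is below `U x₀ - η`, while left of `x₁` it is at least `U x₀`; the
  -- ratio of masses is then of order `exp (-η / ε)`.
  obtain ⟨η, hη, hη'⟩ : ∃ η, 0 < η ∧ U x₂ < U x₀ - η := ⟨(U x₀ - U x₂) / 2, by linarith, by linarith⟩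
  obtain ⟨r, hr, hball⟩ := Metric.eventually_nhds_iff_ball.1
    (hU.continuous.continuousAt.eventually_lt_const hη')
  set K := ∫ x, Real.exp (U x₀ - U x) with hK
  have hKi : Integrable fun x => Real.exp (U x₀ - U x) := by
    refine ((hU.integrable_exp one_pos).const_mul (Real.exp (U x₀))).congr
      (Eventually.of_forall fun x => ?_)
    simp only
    rw [← Real.exp_add]
    ring_nf
  have hbound : ∀ ε, 0 < ε → ε ≤ 1 →
      (gibbs U ε).real {z | z.1 < x₁} ≤ K / (2 * r) * Real.exp (-(η / ε)) := by
    intro ε hε hε1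
    have hint := hU.integrable_exp hε
    have hnum : ∫ x in Set.Iio x₁, Real.exp (-U x / ε) ≤ Real.exp (-U x₀ / ε) * K := by
      rw [hK, ← integral_const_mul]
      refine (setIntegral_mono_on hint.integrableOn (hKi.const_mul _).integrableOn
        measurableSet_Iio fun x hx => ?_).trans (setIntegral_le_integral (hKi.const_mul _)
          (Eventually.of_forall fun x => by positivity))
      rw [← Real.exp_add, Real.exp_le_exp]
      have h1 := hU.le_of_le (le_of_lt hx)
      -- For `ε ≤ 1` the weight relative to `x₀` is dominated by its value at `ε = 1`, whence a
      -- constant `K` independent of `ε`.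
      have h2 : (U x - U x₀) ≤ (U x - U x₀) / ε := by
        rw [le_div_iff₀ hε]
        nlinarith
      rw [sub_div] at h2
      rw [neg_div, neg_div]
      linarith
    have hden : 2 * r * Real.exp ((η - U x₀) / ε) ≤ ∫ x, Real.exp (-U x / ε) := by
      refine le_trans ?_ (setIntegral_le_integral (s := Metric.ball x₂ r) hint
        (Eventually.of_forall fun x => (Real.exp_pos _).le))
      have h1 := setIntegral_mono_on (s := Metric.ball x₂ r) (μ := volume)
        (f := fun _ => Real.exp ((η - U x₀) / ε)) (g := fun x => Real.exp (-U x / ε))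
        (integrableOn_const measure_ball_lt_top.ne) hint.integrableOn measurableSet_ball (fun x hx => by
          rw [Real.exp_le_exp]
          gcongr
          linarith [hball x hx])
      rw [setIntegral_const, measureReal_def, Real.volume_ball,
        ENNReal.toReal_ofReal (by positivity), smul_eq_mul] at h1
      exact h1
    have hpos : 0 < 2 * r * Real.exp ((η - U x₀) / ε) := by positivity
    rw [gibbs_real_left, measureReal_def, tilted_apply_eq_ofReal_integral' _ measurableSet_Iio,
      ENNReal.toReal_ofReal (setIntegral_nonneg measurableSet_Iio fun x _ =>
        div_nonneg (Real.exp_pos _).le (hpos.le.trans hden)), integral_div,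
      div_le_iff₀ (hpos.trans_le hden)]
    refine hnum.trans ?_
    have hK0 : 0 ≤ K := integral_nonneg fun x => (Real.exp_pos _).le
    calc Real.exp (-U x₀ / ε) * K
        = K / (2 * r) * Real.exp (-(η / ε)) * (2 * r * Real.exp ((η - U x₀) / ε)) := by
          have : Real.exp (-U x₀ / ε) = Real.exp (-(η / ε)) * Real.exp ((η - U x₀) / ε) := by
            rw [← Real.exp_add]; ring_nf
          rw [this]
          field_simp
      _ ≤ _ := by gcongr
  refine squeeze_zero' (Eventually.of_forall fun _ => measureReal_nonneg) ?_
    (by simpa using (tendsto_exp_neg_div hη).const_mul (K / (2 * r)))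
  filter_upwards [Ioo_mem_nhdsGT (zero_lt_one (α := ℝ))] with ε hε
  exact hbound ε hε.1 hε.2.le

/-- This is `log (1 - p) ≥ 1 - 1 / (1 - p)`, multiplied by `n`. -/
lemma _root_.VelocityJump.exp_neg_div_le_pow {p : ℝ} (hp : p < 1) (n : ℕ) :
    Real.exp (-(n * p / (1 - p))) ≤ (1 - p) ^ n := by
  have h0 : 0 < 1 - p := by linarith
  have h1 := Real.one_sub_inv_le_log_of_pos h0
  rw [← Real.exp_log h0, ← Real.exp_nat_mul, Real.exp_log h0, Real.exp_le_exp]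
  have h2 : -(n * p / (1 - p)) = n * (1 - (1 - p)⁻¹) := by field_simp; ring
  rw [h2]
  gcongr

variable {Ω : Type*} [MeasurableSpace Ω] {P : Measure Ω} {E : ℕ → Ω → ℝ}

/-- A lower bound, for small `ε`, on the probability that the process is still on the left of `x₁`
at a multiple of the mean hitting time. -/
lemma exists_le_measureReal [IsProbabilityMeasure P] (hU : IsDoubleWell U x₀ x₁ x₂)
    (hE_law : ∀ k, HasLaw (E k) (expMeasure 1) P) (hE_indep : iIndepFun E P)
    {t δ : ℝ} (ht : 0 < t) (hδ : 0 < δ) :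
    ∃ C : ℝ, ∀ ε, 0 < ε → ε ≤ 1 →
      Real.exp (-(((1 + δ) * t + Real.exp (-((U x₁ - U x₀) / 2 / ε))) /
          (1 - Real.exp (-((U x₁ - U x₀) / 2 / ε))))) -
        C * (Real.exp (-((U x₁ - U x₀) / 2 / ε)) / ε ^ 2) ≤
      P.real {ω | (path U ε (x₀, -1) (fun k => E k ω)
        (t * ∫ ω', hittingTime U ε (x₀, -1) x₁ (fun k => E k ω') ∂P)).1 < x₁} := by
  obtain ⟨V, hV⟩ := hU.exists_variance_le
  obtain ⟨κ, hκ, hκ'⟩ := hU.exists_le_meanCycle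
  have hV0 : 0 ≤ V := le_trans (add_nonneg (variance_nonneg _ _) (variance_nonneg _ _))
    (hV 1 one_pos le_rfl)
  refine ⟨((1 + δ) * t + 1) * V / (δ * t * κ) ^ 2, fun ε hε hε1 => ?_⟩
  have hb := hU.barrier_pos
  have hp := hU.successProb_pos hε
  have hpQ := hU.successProb_le hε
  have hQ1 : Real.exp (-((U x₁ - U x₀) / 2 / ε)) < 1 := by
    rw [Real.exp_lt_one_iff, neg_lt_zero]
    positivity
  have hc := hκ' ε hε hε1
  have hv := hV ε hε hε1
  have hv0 : 0 ≤ Var[leftTime U ε x₀; expMeasure 1] + Var[rightTime U ε x₀ x₁; expMeasure 1] :=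
    add_nonneg (variance_nonneg _ _) (variance_nonneg _ _)
  have hτ := hU.integral_hittingTime_le hε hE_law hE_indep
  have hτ0 := integral_hittingTime_nonneg (P := P) (E := E) U ε x₀ x₁
  set Q := Real.exp (-((U x₁ - U x₀) / 2 / ε))
  set p := successProb U ε x₀ x₁
  set c := meanCycle U ε x₀ x₁
  set v := Var[leftTime U ε x₀; expMeasure 1] + Var[rightTime U ε x₀ x₁; expMeasure 1]
  set s := t * ∫ ω', hittingTime U ε (x₀, -1) x₁ (fun k => E k ω') ∂P
  have hκε : 0 < κ * ε := by positivity
  have hc0 : 0 < c := hκε.trans_le hc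
  have hp1 : p < 1 := hpQ.trans_lt hQ1
  -- With this `n` the mean total duration `n * c` exceeds `s ≤ t * c / p` by at least `δ * t * c /
  -- p`, the margin used in Chebyshev's inequality.
  set n := ⌈(1 + δ) * t / p⌉₊
  have hn1 : (1 + δ) * t / p ≤ n := Nat.le_ceil _
  have hn2 : (n : ℝ) < (1 + δ) * t / p + 1 := Nat.ceil_lt_add_one (by positivity)
  have hnp : n * p ≤ (1 + δ) * t + p := by
    have := mul_le_mul_of_nonneg_right hn2.le hp.le
    rwa [add_mul, div_mul_cancel₀ _ hp.ne', one_mul] at this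
  have hs : s ≤ t * (c / p) := mul_le_mul_of_nonneg_left hτ ht.le
  have hgap : δ * t * (c / p) ≤ n * c - s := by
    have h1 : (1 + δ) * t / p * c ≤ n * c := by gcongr
    have h2 : (1 + δ) * t / p * c = t * (c / p) + δ * t * (c / p) := by ring
    linarith
  have hgap0 : 0 < δ * t * (c / p) := by positivity
  have hmain := hU.le_measureReal_path_fst_lt hε hE_law hE_indep (s := s) (by positivity)
    (n := n) (by linarith)
  refine le_trans (sub_le_sub ?_ ?_) hmain
  · refine le_trans ?_ (exp_neg_div_le_pow hp1 n)
    rw [Real.exp_le_exp, neg_le_neg_iff]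
    have h1 : 0 < 1 - Q := by linarith
    refine div_le_div₀ (by positivity) (by linarith) h1 (by linarith)
  -- The variance grows like `1 / p` and the squared margin like `(c / p) ^ 2`, so one factor `p ≤
  -- Q` survives; `c ≥ κ * ε` costs only `1 / ε ^ 2`.
  · calc n * v / (n * c - s) ^ 2 ≤ ((1 + δ) * t + 1) / p * V / (δ * t * (c / p)) ^ 2 := by
          gcongr
          rw [le_div_iff₀ hp]
          linarith
      _ = ((1 + δ) * t + 1) * V / (δ * t * c) ^ 2 * p := by field_simp
      _ ≤ ((1 + δ) * t + 1) * V / (δ * t * (κ * ε)) ^ 2 * Q := by gcongr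
      _ = ((1 + δ) * t + 1) * V / (δ * t * κ) ^ 2 * (Q / ε ^ 2) := by field_simp

/-- The lower bound on the distance to equilibrium. -/
lemma exp_neg_le_liminf [IsProbabilityMeasure P] (hU : IsDoubleWell U x₀ x₁ x₂)
    (hmin : U x₂ < U x₀) (hE_law : ∀ k, HasLaw (E k) (expMeasure 1) P) (hE_indep : iIndepFun E P)
    {t : ℝ} (ht : 0 < t) :
    Real.exp (-t) ≤ liminf (fun ε : ℝ => tvDist (P.map (fun ω => path U ε (x₀, -1)
      (fun k => E k ω) (t * ∫ ω', hittingTime U ε (x₀, -1) x₁ (fun k => E k ω') ∂P)))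
        (gibbs U ε)) (𝓝[>] (0 : ℝ)) := by
  have hb : 0 < (U x₁ - U x₀) / 2 := half_pos hU.barrier_pos
  set D : ℝ → ℝ := fun ε => tvDist (P.map (fun ω => path U ε (x₀, -1)
      (fun k => E k ω) (t * ∫ ω', hittingTime U ε (x₀, -1) x₁ (fun k => E k ω') ∂P)))
        (gibbs U ε) with hD
  have hprob : ∀ ε, 0 < ε → ∀ s, IsProbabilityMeasure
      (P.map fun ω => path U ε (x₀, -1) (fun k => E k ω) s) := fun ε hε s =>
    Measure.isProbabilityMeasure_map (hU.aemeasurable_path hε hE_law _ _)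
  have hD1 : ∀ᶠ ε in 𝓝[>] (0 : ℝ), D ε ≤ 1 := by
    filter_upwards [self_mem_nhdsWithin] with ε hε
    have := hprob ε hε
    have := hU.isProbabilityMeasure_gibbs hε
    exact tvDist_le_one _ _
  -- A real-valued `liminf` is monotone only under boundedness conditions; the total variation
  -- distance is at most `1`.
  have hcob : IsCoboundedUnder (· ≥ ·) (𝓝[>] (0 : ℝ)) D :=
    IsBoundedUnder.isCoboundedUnder_ge ⟨1, eventually_map.2 hD1⟩
  have key : ∀ δ : ℝ, 0 < δ → Real.exp (-((1 + δ) * t)) ≤ liminf D (𝓝[>] (0 : ℝ)) := by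
    intro δ hδ
    obtain ⟨C, hC⟩ := hU.exists_le_measureReal hE_law hE_indep ht hδ
    set G : ℝ → ℝ := fun ε => Real.exp (-(((1 + δ) * t + Real.exp (-((U x₁ - U x₀) / 2 / ε))) /
          (1 - Real.exp (-((U x₁ - U x₀) / 2 / ε))))) -
        C * (Real.exp (-((U x₁ - U x₀) / 2 / ε)) / ε ^ 2) - (gibbs U ε).real {z | z.1 < x₁}
    have hQ := tendsto_exp_neg_div hb
    have hG : Tendsto G (𝓝[>] (0 : ℝ)) (𝓝 (Real.exp (-((1 + δ) * t)))) := by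
      have h1 := (((hQ.const_add ((1 + δ) * t)).div (hQ.const_sub 1) (by norm_num)).neg).rexp
      have h2 := (h1.sub ((tendsto_exp_neg_div_div_sq hb).const_mul C)).sub
        (hU.tendsto_gibbs_left hmin)
      simpa using h2
    rw [← hG.liminf_eq]
    refine liminf_le_liminf ?_ hG.isBoundedUnder_ge hcob
    filter_upwards [Ioo_mem_nhdsGT (zero_lt_one (α := ℝ))] with ε hε
    have := hprob ε hε.1
    have := hU.isProbabilityMeasure_gibbs hε.1
    have hA : MeasurableSet {z : State | z.1 < x₁} := measurable_fst measurableSet_Iio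
    refine le_trans (sub_le_sub_right ?_ _) (sub_le_tvDist _ _ hA)
    rw [map_measureReal_apply_of_aemeasurable (hU.aemeasurable_path hε.1 hE_law _ _) hA]
    exact hC ε hε.1 hε.2.le
  have hlim : Tendsto (fun δ : ℝ => Real.exp (-((1 + δ) * t))) (𝓝[>] 0) (𝓝 (Real.exp (-t))) := by
    have : Continuous fun δ : ℝ => Real.exp (-((1 + δ) * t)) := by fun_prop
    have h := this.tendsto 0
    rw [add_zero, one_mul] at h
    exact h.mono_left nhdsWithin_le_nhds
  exact le_of_tendsto hlim (eventually_nhdsWithin_of_forall fun δ hδ => key δ hδ)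

end IsDoubleWell

end

end VelocityJump

end

theorem mainTheorem9 {Ω : Type*} [MeasurableSpace Ω] (P : Measure Ω) [IsProbabilityMeasure P]
    (E : ℕ → Ω → ℝ) (hE_law : ∀ k, HasLaw (E k) (expMeasure 1) P) (hE_indep : iIndepFun E P)
    (U : ℝ → ℝ) (x₀ x₁ x₂ : ℝ) (hU : VelocityJump.IsDoubleWell U x₀ x₁ x₂)
    (hmin : U x₂ < U x₀) :
    (∀ ε : ℝ, 0 < ε →
      (∀ μ : Measure VelocityJump.State,
        VelocityJump.IsInvariantLaw U ε μ ↔ μ = VelocityJump.gibbs U ε) ∧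
      (∀ s : ℝ, 0 ≤ s →
        AEMeasurable (fun ω => VelocityJump.path U ε (x₀, -1) (fun k => E k ω) s) P) ∧
      Integrable (fun ω => VelocityJump.hittingTime U ε (x₀, -1) x₁ (fun k => E k ω)) P) ∧
    ∀ t : ℝ, 0 < t →
      Real.exp (-t) ≤
        liminf
          (fun ε : ℝ =>
            VelocityJump.tvDist
              (P.map (fun ω => VelocityJump.path U ε (x₀, -1) (fun k => E k ω)
                (t * ∫ ω', VelocityJump.hittingTime U ε (x₀, -1) x₁ (fun k => E k ω') ∂P)))
              (VelocityJump.gibbs U ε))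
          (𝓝[>] (0 : ℝ)) := by
  refine ⟨fun ε hε => ⟨hU.isInvariantLaw_iff hε, fun s _ => hU.aemeasurable_path hε hE_law _ s,
    hU.integrable_hittingTime hε hE_law hE_indep⟩, fun t ht =>
    hU.exp_neg_le_liminf hmin hE_law hE_indep ht⟩
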